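/- Let $n\ge 1$, let $v:\mathbb R^d\to\mathbb R^d$ be Lipschitz and bounded, with flow $\Phi^v_t$ ($t\in\mathbb R$), and let $\omega\subset\mathbb R^d$ be open, connected and bounded. Let $X^0=\{x^0_1,\dots,x^0_n\}$ and $X^1=\{x^1_1,\dots,x^1_n\}$ be disjoint configurations in $\mathbb R^d$ (that is, $x^l_i\ne x^l_j$ for $i\neq j$, $l\in\{0,1\}$), with empirical measures $\mu^l=\frac1n\sum_{i=1}^n\delta_{x^l_i}$. Put $$t^0(x)=\inf\{t\ge 0:\Phi^v_t(x)\in\omega\},\qquad t^1(x)=\inf\{t\ge0:\Phi^v_{-t}(x)\in\omega\}.$$ Assume the geometric condition: for every $x\in\operatorname{supp}\mu^0$ there is $t>0$ with $\Phi^v_t(x)\in\omega$, and for every $x\in\operatorname{supp}\mu^1$ there is $t>0$ with $\Phi^v_{-t}(x)\in\omega$. For $t\ge0$ and $m\in[0,1]$ let $$\mathcal F_{\mu^0}(t)=\mu^0(\{x\in\operatorname{supp}\mu^0:t^0(x)\le t\}),\qquad \mathcal B_{\mu^1}(t)=\mu^1(\{x\in\operatorname{supp}\mu^1:t^1(x)\le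 t\}),$$ $$\mathcal F_{\mu^0}^{-1}(m)=\inf\{t\ge0:\mathcal F_{\mu^0}(t)\ge m\},\qquad \mathcal B_{\mu^1}^{-1}(m)=\inf\{t\ge0:\mathcal B_{\mu^1}(t)\ge m\},$$ $$S(\mu^0,\mu^1)=\sup_{m\in[0,1]}\{\mathcal F_{\mu^0}^{-1}(m)+\mathcal B_{\mu^1}^{-1}(1-m)\}.$$ A control $\mathbb 1_\omega u$ satisfies the Carathéodory condition if $x\mapsto\mathbb 1_\omega(x)u(x,t)$ is Lipschitz with a constant independent of $t$, $t\mapsto\mathbb 1_\omega(x)u(x,t)$ is measurable for each $x$, and $\mathbb 1_\omega u$ is bounded. Call $T\ge0$ a time of exact controllability from $X^0$ to $X^1$ if, for some control satisfying the Carathéodory condition, the solutions of $$\dot x_i(t)=v(x_i(t))+\mathbb 1_\omega(x_i(t))u(x_i(t),t)\ \text{ for a.e. } t\ge 0,\qquad x_i(0)=x^0_i,\qquad i=1,\dots,n,$$ satisfy $\{x_1(T),\dots,x_n(T)\}=X^1$. With $M_e^*=\max\{t^0(x^0_i),t^1(x^1_i):1\le i\le n\}$, a value $\tau\in[0,\infty]$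 is called the infimum time $T_e(X^0,X^1)$ for exact control if (i) every $T>\tau$ is a time of exact controllability; (ii) no $T\in(M_e^*,\tau]$ is a time of exact controllability; (iii) at most finitely many $T\in[0,M_e^*]$ are times of exact controllability. Then $S(\mu^0,\mu^1)$ is finite, and it is the infimum time $T_e(X^0,X^1)$: it satisfies (i)–(iii), and it is the only $\tau\in[0,\infty]$ that does. -/

import Mathlib

open MeasureTheory Set
open scoped NNReal ENNReal

/-- Existence of a global integral curve of a bounded Lipschitz field through every point. -/
theorem exists_globalIntegralCurve {d : ℕ}
    {v : EuclideanSpace ℝ (Fin d) → EuclideanSpace ℝ (Fin d)} {K M : ℝ≥0}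
    (hK : LipschitzWith K v) (hM : ∀ x, ‖v x‖ ≤ M) (x : EuclideanSpace ℝ (Fin d)) :
    ∃ γ : ℝ → EuclideanSpace ℝ (Fin d), γ 0 = x ∧ IsIntegralCurve γ (fun _ => v) := by
  have key : ∀ N : ℕ, ∃ α : ℝ → EuclideanSpace ℝ (Fin d), α 0 = x ∧
      ∀ t ∈ Icc (-(N : ℝ)) N, HasDerivWithinAt α (v (α t)) (Icc (-(N : ℝ)) N) t := by
    intro N
    have h0 : (0 : ℝ) ∈ Icc (-(N : ℝ)) N := by simp
    have hP : IsPicardLindelof (fun _ : ℝ => v) (⟨0, h0⟩ : Icc (-(N : ℝ)) (N : ℝ)) x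
        (M * N) 0 M K :=
      { lipschitzOnWith := fun _ _ => hK.lipschitzOnWith
        continuousOn := fun _ _ => continuousOn_const
        norm_le := fun _ _ y _ => hM y
        mul_max_le := by simp }
    exact hP.exists_eq_forall_mem_Icc_hasDerivWithinAt₀
  choose α hα0 hα using key
  have hint : ∀ N : ℕ, ∀ t ∈ Ioo (-(N : ℝ)) N, HasDerivAt (α N) (v (α N t)) t := fun N t ht =>
    (hα N t (Ioo_subset_Icc_self ht)).hasDerivAt (Icc_mem_nhds ht.1 ht.2)
  have hcompat : ∀ N P : ℕ, N ≤ P → ∀ t ∈ Ioo (-(N : ℝ)) N, α N t = α P t := by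
    intro N P hNP t ht
    have hNP' : (N : ℝ) ≤ P := by exact_mod_cast hNP
    have hN : (0 : ℝ) < N := by linarith [ht.1, ht.2]
    refine ODE_solution_unique_of_mem_Ioo (v := fun _ => v) (s := fun _ => univ) (K := K)
      (t₀ := 0) (fun _ _ => hK.lipschitzOnWith) (⟨by linarith, hN⟩ : (0 : ℝ) ∈ Ioo (-(N : ℝ)) N)
      (fun s hs => ⟨hint N s hs, mem_univ _⟩)
      (fun s hs => ⟨hint P s ⟨by linarith [hs.1], by linarith [hs.2]⟩, mem_univ _⟩)
      (by rw [hα0, hα0]) ht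
  have hmem : ∀ t : ℝ, t ∈ Ioo (-((⌈|t|⌉₊ + 1 : ℕ) : ℝ)) ((⌈|t|⌉₊ + 1 : ℕ) : ℝ) := by
    intro t
    have h1 := Nat.le_ceil |t|
    push_cast
    constructor <;> linarith [neg_abs_le t, le_abs_self t]
  refine ⟨fun t => α (⌈|t|⌉₊ + 1) t, hα0 _, fun t => ?_⟩
  refine (hint _ t (hmem t)).congr_of_eventuallyEq ?_
  filter_upwards [Ioo_mem_nhds (hmem t).1 (hmem t).2] with s hs
  rcases le_total (⌈|s|⌉₊ + 1) (⌈|t|⌉₊ + 1) with h | h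
  · exact hcompat _ _ h s (hmem s)
  · exact (hcompat _ _ h s hs).symm

open scoped Classical in
/-- The flow `Φ_t^v(x)`, `t ∈ ℝ`, of an autonomous vector field `v`: the value at time `t` of the
integral curve of `v` that is at `x` at time `0`. For a bounded Lipschitz `v` this curve exists and
is unique (`vectorFlow_spec`, `eq_vectorFlow`). -/
noncomputable def vectorFlow {d : ℕ} (v : EuclideanSpace ℝ (Fin d) → EuclideanSpace ℝ (Fin d))
    (t : ℝ) (x : EuclideanSpace ℝ (Fin d)) : EuclideanSpace ℝ (Fin d) :=
  if h : ∃ γ : ℝ → EuclideanSpace ℝ (Fin d), γ 0 = x ∧ IsIntegralCurve γ (fun _ => v) then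
    h.choose t
  else x

theorem vectorFlow_spec {d : ℕ} {v : EuclideanSpace ℝ (Fin d) → EuclideanSpace ℝ (Fin d)}
    {K M : ℝ≥0} (hK : LipschitzWith K v) (hM : ∀ x, ‖v x‖ ≤ M) (x : EuclideanSpace ℝ (Fin d)) :
    vectorFlow v 0 x = x ∧ IsIntegralCurve (fun t => vectorFlow v t x) (fun _ => v) := by
  have h := exists_globalIntegralCurve hK hM x
  have e : (fun t => vectorFlow v t x) = h.choose := by
    funext t
    simp only [vectorFlow, dif_pos h]
  refine ⟨?_, e ▸ h.choose_spec.2⟩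
  have h0 : vectorFlow v 0 x = h.choose 0 := congrFun e 0
  rw [h0, h.choose_spec.1]

theorem eq_vectorFlow {d : ℕ} {v : EuclideanSpace ℝ (Fin d) → EuclideanSpace ℝ (Fin d)}
    {K M : ℝ≥0} (hK : LipschitzWith K v) (hM : ∀ x, ‖v x‖ ≤ M) {x : EuclideanSpace ℝ (Fin d)}
    {γ : ℝ → EuclideanSpace ℝ (Fin d)} (h0 : γ 0 = x) (hγ : IsIntegralCurve γ (fun _ => v))
    (t : ℝ) : γ t = vectorFlow v t x := by
  obtain ⟨h1, h2⟩ := vectorFlow_spec hK hM x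
  have := ODE_solution_unique_univ (v := fun _ => v) (s := fun _ => univ) (K := K) (t₀ := 0)
    (f := γ) (g := fun t => vectorFlow v t x) (fun _ => hK.lipschitzOnWith)
    (fun s => ⟨hγ s, mem_univ _⟩) (fun s => ⟨h2 s, mem_univ _⟩) (by rw [h0, h1])
  exact congrFun this t

/-- `t⁰(x) = inf {t ≥ 0 : Φ_t^v(x) ∈ ω}`, with value `∞` if the trajectory never meets `ω`. -/
noncomputable def entryTime {d : ℕ} (v : EuclideanSpace ℝ (Fin d) → EuclideanSpace ℝ (Fin d))
    (ω : Set (EuclideanSpace ℝ (Fin d))) (x : EuclideanSpace ℝ (Fin d)) : ℝ≥0∞ :=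
  ⨅ (t : ℝ≥0) (_ : vectorFlow v (t : ℝ) x ∈ ω), (t : ℝ≥0∞)

/-- `t¹(x) = inf {t ≥ 0 : Φ_{-t}^v(x) ∈ ω}`, with value `∞` if there is no such `t`. -/
noncomputable def backwardEntryTime {d : ℕ}
    (v : EuclideanSpace ℝ (Fin d) → EuclideanSpace ℝ (Fin d))
    (ω : Set (EuclideanSpace ℝ (Fin d))) (x : EuclideanSpace ℝ (Fin d)) : ℝ≥0∞ :=
  ⨅ (t : ℝ≥0) (_ : vectorFlow v (-(t : ℝ)) x ∈ ω), (t : ℝ≥0∞)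

/-- The geometric condition on a pair of measures. -/
def GeometricCondition {d : ℕ} (v : EuclideanSpace ℝ (Fin d) → EuclideanSpace ℝ (Fin d))
    (ω : Set (EuclideanSpace ℝ (Fin d))) (μ₀ μ₁ : Measure (EuclideanSpace ℝ (Fin d))) : Prop :=
  (∀ x ∈ μ₀.support, ∃ t : ℝ, 0 < t ∧ vectorFlow v t x ∈ ω) ∧
  (∀ x ∈ μ₁.support, ∃ t : ℝ, 0 < t ∧ vectorFlow v (-t) x ∈ ω)

/-- The empirical measure `∑ i, (1/n) δ_{x i}` of a configuration of `n` points. -/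
noncomputable def empiricalMeasure {d n : ℕ} (x : Fin n → EuclideanSpace ℝ (Fin d)) :
    Measure (EuclideanSpace ℝ (Fin d)) :=
  ∑ i, (n : ℝ≥0∞)⁻¹ • Measure.dirac (x i)

/-- `F_μ(t) = μ {x ∈ supp μ : t⁰(x) ≤ t}`. -/
noncomputable def forwardMass {d : ℕ} (v : EuclideanSpace ℝ (Fin d) → EuclideanSpace ℝ (Fin d))
    (ω : Set (EuclideanSpace ℝ (Fin d))) (μ : Measure (EuclideanSpace ℝ (Fin d)))
    (t : ℝ≥0) : ℝ≥0∞ :=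
  μ {x | x ∈ μ.support ∧ entryTime v ω x ≤ t}

/-- `B_μ(t) = μ {x ∈ supp μ : t¹(x) ≤ t}`. -/
noncomputable def backwardMass {d : ℕ} (v : EuclideanSpace ℝ (Fin d) → EuclideanSpace ℝ (Fin d))
    (ω : Set (EuclideanSpace ℝ (Fin d))) (μ : Measure (EuclideanSpace ℝ (Fin d)))
    (t : ℝ≥0) : ℝ≥0∞ :=
  μ {x | x ∈ μ.support ∧ backwardEntryTime v ω x ≤ t}

/-- The generalized inverse `inf {t ≥ 0 : G(t) ≥ m}` of a function `G` on `[0, ∞)`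
(`∞` if there is no such `t`). -/
noncomputable def generalizedInverse (G : ℝ≥0 → ℝ≥0∞) (m : ℝ≥0∞) : ℝ≥0∞ :=
  ⨅ (t : ℝ≥0) (_ : m ≤ G t), (t : ℝ≥0∞)

/-- `S(μ₀, μ₁) = sup_{m ∈ [0,1]} (F_{μ₀}⁻¹(m) + B_{μ₁}⁻¹(1 - m))`. -/
noncomputable def macroscopicTime {d : ℕ}
    (v : EuclideanSpace ℝ (Fin d) → EuclideanSpace ℝ (Fin d))
    (ω : Set (EuclideanSpace ℝ (Fin d))) (μ₀ μ₁ : Measure (EuclideanSpace ℝ (Fin d))) : ℝ≥0∞ :=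
  ⨆ m ∈ Icc (0 : ℝ≥0∞) 1,
    generalizedInverse (forwardMass v ω μ₀) m + generalizedInverse (backwardMass v ω μ₁) (1 - m)

/-- The Carathéodory condition for the localized control `(x, t) ↦ 1_ω(x) u(x, t)`: it is Lipschitz
in `x` (uniformly in time, so that trajectories are unique), measurable in `t`, and bounded. -/
structure IsAdmissibleControl {d : ℕ} (ω : Set (EuclideanSpace ℝ (Fin d)))
    (u : EuclideanSpace ℝ (Fin d) → ℝ → EuclideanSpace ℝ (Fin d)) : Prop where
  lipschitz : ∃ L : ℝ≥0, ∀ t, LipschitzWith L (ω.indicator fun x => u x t)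
  measurable : ∀ x, Measurable fun t => ω.indicator (fun y => u y t) x
  bounded : ∃ M : ℝ≥0, ∀ x t, ‖ω.indicator (fun y => u y t) x‖ ≤ M

/-- `x` is the (Carathéodory) solution on `[0, ∞)` of `x'(t) = v(x(t)) + 1_ω(x(t)) u(x(t), t)` for
almost every `t`, with `x(0) = p`, in integral form. -/
def IsControlledTrajectory {d : ℕ} (v : EuclideanSpace ℝ (Fin d) → EuclideanSpace ℝ (Fin d))
    (ω : Set (EuclideanSpace ℝ (Fin d)))
    (u : EuclideanSpace ℝ (Fin d) → ℝ → EuclideanSpace ℝ (Fin d))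
    (p : EuclideanSpace ℝ (Fin d)) (x : ℝ → EuclideanSpace ℝ (Fin d)) : Prop :=
  ∀ t : ℝ, 0 ≤ t →
    IntervalIntegrable (fun s => v (x s) + ω.indicator (fun y => u y s) (x s)) volume 0 t ∧
    x t = p + ∫ s in (0 : ℝ)..t, (v (x s) + ω.indicator (fun y => u y s) (x s))

/-- The microscopic system is exactly controllable from `x₀` to `x₁` at time `T`: some admissible
control steers the points of `x₀` to the points of `x₁`, configurations being unordered. -/
def ExactlyControllable {d n : ℕ} (v : EuclideanSpace ℝ (Fin d) → EuclideanSpace ℝ (Fin d))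
    (ω : Set (EuclideanSpace ℝ (Fin d))) (x₀ x₁ : Fin n → EuclideanSpace ℝ (Fin d))
    (T : ℝ≥0) : Prop :=
  ∃ u : EuclideanSpace ℝ (Fin d) → ℝ → EuclideanSpace ℝ (Fin d), IsAdmissibleControl ω u ∧
    ∃ X : Fin n → ℝ → EuclideanSpace ℝ (Fin d),
      (∀ i, IsControlledTrajectory v ω u (x₀ i) (X i)) ∧
      ∃ σ : Equiv.Perm (Fin n), ∀ i, X i T = x₁ (σ i)

/-- `M*_e(X⁰, X¹) = max {t⁰(x₀ i), t¹(x₁ i) : i}`. -/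
noncomputable def maxEntryTime {d n : ℕ} (v : EuclideanSpace ℝ (Fin d) → EuclideanSpace ℝ (Fin d))
    (ω : Set (EuclideanSpace ℝ (Fin d))) (x₀ x₁ : Fin n → EuclideanSpace ℝ (Fin d)) : ℝ≥0∞ :=
  ⨆ i, max (entryTime v ω (x₀ i)) (backwardEntryTime v ω (x₁ i))

/-- `τ` is the infimum time for exact control from `x₀` to `x₁`: every later time is a time of exact
controllability, no time in `(M*_e, τ]` is, and at most finitely many times in `[0, M*_e]` are. -/
structure IsExactInfimumTime {d n : ℕ}
    (v : EuclideanSpace ℝ (Fin d) → EuclideanSpace ℝ (Fin d))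
    (ω : Set (EuclideanSpace ℝ (Fin d))) (x₀ x₁ : Fin n → EuclideanSpace ℝ (Fin d))
    (τ : ℝ≥0∞) : Prop where
  controllable : ∀ T : ℝ≥0, τ < T → ExactlyControllable v ω x₀ x₁ T
  not_controllable : ∀ T : ℝ≥0, maxEntryTime v ω x₀ x₁ < T → (T : ℝ≥0∞) ≤ τ →
    ¬ ExactlyControllable v ω x₀ x₁ T
  finite_exceptional :
    {T : ℝ≥0 | (T : ℝ≥0∞) ≤ maxEntryTime v ω x₀ x₁ ∧ ExactlyControllable v ω x₀ x₁ T}.Finite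

/-! ### The free flow and its entry times into `ω` -/

section Flow

variable {d : ℕ} {v : EuclideanSpace ℝ (Fin d) → EuclideanSpace ℝ (Fin d)} {K M : ℝ≥0}

/-! Write `α i` for the entry time of `x₀ i` and `β j` for the backward entry time of `x₁ j`. The
control does nothing outside `ω`, so a trajectory from `x₀ i` to `x₁ j` in time T is free on `[0, α
i]` and on `[T - β j, T]`. If `α i < T`, these two intervals cannot cover `[0, T]`: the trajectory
would be free throughout, and a free trajectory that meets the open set `ω` before T stays there for
a while, so that `α i + β j < T` after all (`IsControlledTrajectory.add_lt`). Hence, beyond the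
maximal entry time, control at T requires a permutation `σ` with `α i + β (σ i) < T` for all `i`.

Such a permutation is also sufficient. Each `x₀ i` is driven to `x₁ (σ i)` by a curve that follows
the flow into `ω`, crosses `ω`, and follows the flow out to its target. These curves can meet only
in a compact part of `ω`, at times in `(0, T)`, but a Lipschitz control allows no meeting at all. In
dimension at least two, a small generic shift of one curve at a time removes the meetings, since the
bad directions form a set of dimension at most one. On the line the curves are sorted and then
spread apart; this permutes the targets, which is harmless for unordered configurations. Disjoint
curves are realized by a sum of tent functions centred on them.

It remains to see that the supremum S of opposite quantile sums is the minimum over `σ` of the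
maximum of `α i + β (σ i)`: a counting argument bounds S by that maximum for every `σ`, and pairing
small `α` with large `β` attains it. Finally, for T at most the maximal entry time, some initial
point or target is joined to the other configuration by a free arc of duration T; the arc is
injective and the configuration finite, so only finitely many T occur. -/

theorem vectorFlow_zero (hK : LipschitzWith K v) (hM : ∀ x, ‖v x‖ ≤ M)
    (x : EuclideanSpace ℝ (Fin d)) : vectorFlow v 0 x = x :=
  (vectorFlow_spec hK hM x).1

theorem hasDerivAt_vectorFlow (hK : LipschitzWith K v) (hM : ∀ x, ‖v x‖ ≤ M)
    (x : EuclideanSpace ℝ (Fin d)) (t : ℝ) :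
    HasDerivAt (fun t => vectorFlow v t x) (v (vectorFlow v t x)) t :=
  (vectorFlow_spec hK hM x).2 t

theorem lipschitzWith_vectorFlow (hK : LipschitzWith K v) (hM : ∀ x, ‖v x‖ ≤ M)
    (x : EuclideanSpace ℝ (Fin d)) : LipschitzWith M (fun t => vectorFlow v t x) := by
  refine lipschitzWith_of_nnnorm_deriv_le
    (fun t => (hasDerivAt_vectorFlow hK hM x t).differentiableAt) fun t => ?_
  rw [(hasDerivAt_vectorFlow hK hM x t).deriv]
  exact hM _

theorem continuous_vectorFlow (hK : LipschitzWith K v) (hM : ∀ x, ‖v x‖ ≤ M)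
    (x : EuclideanSpace ℝ (Fin d)) : Continuous (fun t => vectorFlow v t x) :=
  (lipschitzWith_vectorFlow hK hM x).continuous

theorem vectorFlow_add (hK : LipschitzWith K v) (hM : ∀ x, ‖v x‖ ≤ M) (s t : ℝ)
    (x : EuclideanSpace ℝ (Fin d)) :
    vectorFlow v (s + t) x = vectorFlow v s (vectorFlow v t x) := by
  refine eq_vectorFlow hK hM (γ := fun s => vectorFlow v (s + t) x) (by simp) (fun r => ?_) s
  exact (hasDerivAt_vectorFlow hK hM x (r + t)).comp_add_const r t

theorem vectorFlow_neg_vectorFlow (hK : LipschitzWith K v) (hM : ∀ x, ‖v x‖ ≤ M) (t : ℝ)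
    (x : EuclideanSpace ℝ (Fin d)) : vectorFlow v (-t) (vectorFlow v t x) = x := by
  rw [← vectorFlow_add hK hM, neg_add_cancel, vectorFlow_zero hK hM]

theorem vectorFlow_injective (hK : LipschitzWith K v) (hM : ∀ x, ‖v x‖ ≤ M) (t : ℝ) :
    Function.Injective (vectorFlow v t) :=
  Function.LeftInverse.injective (vectorFlow_neg_vectorFlow hK hM t)

/-- Reversing time turns `v` into `-v`, so backward entry times are handled as forward entry times
of `-v`. -/
theorem vectorFlow_neg_time (hK : LipschitzWith K v) (hM : ∀ x, ‖v x‖ ≤ M) (t : ℝ)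
    (x : EuclideanSpace ℝ (Fin d)) : vectorFlow v (-t) x = vectorFlow (-v) t x := by
  refine eq_vectorFlow (γ := fun t => vectorFlow v (-t) x) hK.neg (M := M)
    (fun y => by simpa using hM y) (by simpa using vectorFlow_zero hK hM x) (fun s => ?_) t
  have := (hasDerivAt_vectorFlow hK hM x (-s)).scomp s (hasDerivAt_neg s)
  rw [neg_one_smul] at this
  exact this

theorem backwardEntryTime_eq_entryTime_neg (hK : LipschitzWith K v) (hM : ∀ x, ‖v x‖ ≤ M)
    (ω : Set (EuclideanSpace ℝ (Fin d))) (x : EuclideanSpace ℝ (Fin d)) :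
    backwardEntryTime v ω x = entryTime (-v) ω x := by
  simp only [backwardEntryTime, entryTime, vectorFlow_neg_time hK hM]

/-- `τ` is the infimum of the times `t ≥ 0` at which the trajectory of `x` lies in `ω`,
these times being non-empty. -/
structure IsEntryTime (v : EuclideanSpace ℝ (Fin d) → EuclideanSpace ℝ (Fin d))
    (ω : Set (EuclideanSpace ℝ (Fin d))) (x : EuclideanSpace ℝ (Fin d)) (τ : ℝ) : Prop where
  nonneg : 0 ≤ τ
  notMem : ∀ t, 0 ≤ t → t < τ → vectorFlow v t x ∉ ω
  exists_mem : ∀ ε, 0 < ε → ∃ t, τ ≤ t ∧ t < τ + ε ∧ vectorFlow v t x ∈ ω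

/-- The infimum need not be attained, `ω` being open in the application; hence visits to `ω` are
only asserted at times in `[τ, τ + ε)`. -/
theorem exists_isEntryTime {ω : Set (EuclideanSpace ℝ (Fin d))} {x : EuclideanSpace ℝ (Fin d)}
    (h : ∃ t : ℝ, 0 < t ∧ vectorFlow v t x ∈ ω) :
    ∃ τ : ℝ≥0, entryTime v ω x = τ ∧ IsEntryTime v ω x τ := by
  have hle : ∀ t : ℝ≥0, vectorFlow v (t : ℝ) x ∈ ω → entryTime v ω x ≤ t := fun t ht =>
    iInf₂_le (f := fun (t : ℝ≥0) (_ : vectorFlow v (t : ℝ) x ∈ ω) => (t : ℝ≥0∞)) t ht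
  have hfin : entryTime v ω x ≠ ∞ := by
    obtain ⟨t, ht, hmem⟩ := h
    exact ne_top_of_le_ne_top ENNReal.coe_ne_top (hle ⟨t, ht.le⟩ hmem)
  obtain ⟨τ, hτ⟩ := WithTop.ne_top_iff_exists.1 hfin
  change (τ : ℝ≥0∞) = _ at hτ
  refine ⟨τ, hτ.symm, τ.2, fun t ht htτ hmem => ?_, fun ε hε => ?_⟩
  · lift t to ℝ≥0 using ht
    have := hle t hmem
    rw [← hτ, ENNReal.coe_le_coe] at this
    exact absurd htτ (not_lt.2 (by exact_mod_cast this))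
  · by_contra! hcon
    lift ε to ℝ≥0 using hε.le
    have : ((τ + ε : ℝ≥0) : ℝ≥0∞) ≤ entryTime v ω x := by
      refine le_iInf₂ fun t ht => ENNReal.coe_le_coe.2 ?_
      by_contra! hlt
      refine hcon t ?_ (by exact_mod_cast hlt) ht
      have := hle t ht
      rw [← hτ, ENNReal.coe_le_coe] at this
      exact_mod_cast this
    rw [← hτ, ENNReal.coe_le_coe, ← NNReal.coe_le_coe] at this
    push_cast at this
    linarith

/-- If the free flow carries `p` to `q` in time `T` and meets `ω` before `T`, then the first entry
of `p` strictly precedes the last exit towards `q`. -/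
theorem IsEntryTime.add_lt_of_vectorFlow_eq (hK : LipschitzWith K v) (hM : ∀ x, ‖v x‖ ≤ M)
    {ω : Set (EuclideanSpace ℝ (Fin d))} (hω : IsOpen ω) {p q : EuclideanSpace ℝ (Fin d)}
    {α β T : ℝ} (hα : IsEntryTime v ω p α) (hβ : IsEntryTime (-v) ω q β) (hT : α < T)
    (hpq : vectorFlow v T p = q) : α + β < T := by
  obtain ⟨a, ha, haT, hmem⟩ := hα.exists_mem (T - α) (by linarith)
  -- Openness of `ω` provides a second visit at some `b` in `(a, T)`; the gap between `a` and `b`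
  -- makes the final inequality strict.
  have hnhds : ∀ᶠ t in nhds a, vectorFlow v t p ∈ ω :=
    (continuous_vectorFlow hK hM p).continuousAt.eventually (hω.mem_nhds hmem)
  have hlt : ∀ᶠ t in nhds a, t < T := eventually_lt_nhds (by linarith)
  obtain ⟨b, ⟨hb, hbT⟩, hab⟩ :=
    (((hnhds.and hlt).filter_mono nhdsWithin_le_nhds).and
      (self_mem_nhdsWithin (s := Ioi a))).exists
  have hb' : vectorFlow (-v) (T - b) q = vectorFlow v b p := by
    rw [← vectorFlow_neg_time hK hM, ← hpq, ← vectorFlow_add hK hM]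
    congr 1; ring
  have : β ≤ T - b := by
    by_contra! hcon
    exact hβ.notMem _ (by linarith) hcon (hb' ▸ hb)
  have hab' : a < b := hab
  linarith

/-- A repeated point would make the free trajectory periodic with period at most `α`, so its visit
to `ω` would recur at a time before `α`. -/
theorem IsEntryTime.injOn_vectorFlow (hK : LipschitzWith K v) (hM : ∀ x, ‖v x‖ ≤ M)
    {ω : Set (EuclideanSpace ℝ (Fin d))} {p : EuclideanSpace ℝ (Fin d)}
    {α : ℝ} (hα : IsEntryTime v ω p α) : InjOn (fun t => vectorFlow v t p) (Icc 0 α) := by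
  have key : ∀ s ∈ Icc 0 α, ∀ t ∈ Icc 0 α, s < t → vectorFlow v s p ≠ vectorFlow v t p := by
    intro s hs t ht hst heq
    have hper : Function.Periodic (fun r => vectorFlow v r p) (t - s) := fun r => by
      change vectorFlow v (r + (t - s)) p = vectorFlow v r p
      rw [show r + (t - s) = (r - s) + t by ring, vectorFlow_add hK hM, ← heq,
        ← vectorFlow_add hK hM]
      congr 1; ring
    obtain ⟨a, -, -, ha⟩ := hα.exists_mem 1 one_pos
    obtain ⟨b, hb, hab⟩ := hper.exists_mem_Ico (sub_pos.2 hst) a s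
    refine hα.notMem b (hs.1.trans hb.1) (lt_of_lt_of_le hb.2 (by linarith [ht.2])) ?_
    change vectorFlow v a p = vectorFlow v b p at hab
    rwa [← hab]
  intro s hs t ht heq
  rcases lt_trichotomy s t with h | h | h
  · exact absurd heq (key s hs t ht h)
  · exact h
  · exact absurd heq.symm (key t ht s hs h)

end Flow

/-! ### Controlled trajectories are free outside `ω` -/

section Uniqueness

/-- Grönwall's lemma in integral form: a primitive bounded by a multiple of itself vanishes. -/
theorem integral_eq_zero_of_norm_le_mul_norm_integral {E : Type*} [NormedAddCommGroup E]
    [NormedSpace ℝ E] {g : ℝ → E} {C R : ℝ} (hg : IntervalIntegrable g volume 0 R)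
    (hb : ∀ s ∈ Ioo 0 R, ‖g s‖ ≤ C * ‖∫ r in (0 : ℝ)..s, g r‖) :
    ∀ t ∈ Icc 0 R, ∫ r in (0 : ℝ)..t, g r = 0 := by
  rcases lt_or_ge R 0 with hR | hR
  · intro t ht
    exact absurd (ht.1.trans ht.2) (not_le.2 hR)
  have hcont : ContinuousOn (fun t => ‖∫ r in (0 : ℝ)..t, g r‖) (Icc 0 R) := by
    have := intervalIntegral.continuousOn_primitive_interval' hg left_mem_uIcc
    rw [uIcc_of_le hR] at this
    exact this.norm
  set h : ℝ → ℝ := fun t => ‖∫ r in (0 : ℝ)..t, g r‖ with hh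
  -- a continuous extension of `h` to the line
  set h' : ℝ → ℝ := IccExtend hR (domRestrict (Icc 0 R) h) with hh'
  have hh'c : Continuous h' := (continuousOn_iff_continuous_domRestrict.1 hcont).Icc_extend'
  have hh'e : ∀ t ∈ Icc 0 R, h' t = h t := fun t ht => IccExtend_of_mem _ _ ht
  have hh'n : ∀ t, 0 ≤ h' t := fun t => norm_nonneg _
  set φ : ℝ → ℝ := fun t => ∫ r in (0 : ℝ)..t, h' r with hφ
  have hφd : ∀ t, HasDerivAt φ (h' t) t := fun t => hh'c.integral_hasStrictDerivAt 0 t |>.hasDerivAt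
  have hle : ∀ t ∈ Icc 0 R, h' t ≤ C * φ t := by
    intro t ht
    rw [hh'e t ht, hφ, ← intervalIntegral.integral_const_mul]
    refine intervalIntegral.norm_integral_le_of_norm_le ht.1 ?_
      ((hh'c.const_mul C).intervalIntegrable _ _)
    -- The bound is assumed on the open interval only; the endpoint is negligible.
    have hne : ∀ᵐ s : ℝ, s ≠ R := by simp [ae_iff]
    filter_upwards [hne] with s hs hst
    have hsR : s < R := lt_of_le_of_ne (hst.2.trans ht.2) hs
    rw [hh'e s ⟨hst.1.le, hsR.le⟩]
    exact hb s ⟨hst.1, hsR⟩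
  have hφn : ∀ t, 0 ≤ t → 0 ≤ φ t := fun t ht =>
    intervalIntegral.integral_nonneg ht fun s _ => hh'n s
  have hzero := eq_zero_of_abs_deriv_le_mul_abs_self_of_eq_zero_right (f := φ) (f' := h')
    (K := C) (a := 0) (b := R)
    (fun t _ => (hφd t).continuousAt.continuousWithinAt)
    (fun t _ => (hφd t).hasDerivWithinAt) (by simp [hφ]) (fun t ht => by
      rw [Real.norm_of_nonneg (hh'n t), Real.norm_of_nonneg (hφn t ht.1)]
      exact hle t ⟨ht.1, ht.2.le⟩)
  intro t ht
  have h1 := hle t ht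
  rw [hzero t ht, mul_zero, hh'e t ht] at h1
  exact norm_le_zero_iff.1 h1

variable {d : ℕ} {v : EuclideanSpace ℝ (Fin d) → EuclideanSpace ℝ (Fin d)} {K M : ℝ≥0}
  {ω : Set (EuclideanSpace ℝ (Fin d))}
  {u : EuclideanSpace ℝ (Fin d) → ℝ → EuclideanSpace ℝ (Fin d)}
  {p : EuclideanSpace ℝ (Fin d)} {X : ℝ → EuclideanSpace ℝ (Fin d)}

theorem vectorFlow_eq_add_integral (hK : LipschitzWith K v) (hM : ∀ x, ‖v x‖ ≤ M)
    (x : EuclideanSpace ℝ (Fin d)) (t : ℝ) :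
    vectorFlow v t x = x + ∫ s in (0 : ℝ)..t, v (vectorFlow v s x) := by
  rw [intervalIntegral.integral_eq_sub_of_hasDerivAt
    (fun s _ => hasDerivAt_vectorFlow hK hM x s)
    ((hK.continuous.comp (continuous_vectorFlow hK hM x)).intervalIntegrable _ _),
    vectorFlow_zero hK hM]
  abel

/-- The localized control vanishes at `y`, so its Lipschitz constant bounds its size at `x`. This is
the Grönwall estimate in both time directions, and only the free curve has to avoid `ω`. -/
theorem norm_controlled_sub_le (hK : LipschitzWith K v) {L : ℝ≥0}
    (hL : ∀ t, LipschitzWith L (ω.indicator fun x => u x t)) {x y : EuclideanSpace ℝ (Fin d)}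
    (hy : y ∉ ω) (s : ℝ) :
    ‖v x + ω.indicator (fun y => u y s) x - v y‖ ≤ (K + L : ℝ) * ‖x - y‖ := by
  have h1 := hK.norm_sub_le x y
  have h2 := (hL s).norm_sub_le x y
  rw [indicator_of_notMem hy, sub_zero] at h2
  calc ‖v x + ω.indicator (fun y => u y s) x - v y‖
      = ‖(v x - v y) + ω.indicator (fun y => u y s) x‖ := by congr 1; abel
    _ ≤ K * ‖x - y‖ + L * ‖x - y‖ := (norm_add_le _ _).trans (add_le_add h1 h2)
    _ = _ := by ring

/-- A controlled trajectory follows the free flow as long as the latter avoids `ω`. -/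
theorem IsControlledTrajectory.eq_vectorFlow (hK : LipschitzWith K v) (hM : ∀ x, ‖v x‖ ≤ M)
    (hu : IsAdmissibleControl ω u) (hX : IsControlledTrajectory v ω u p X) {R : ℝ} (hR : 0 ≤ R)
    (hfree : ∀ t, 0 ≤ t → t < R → vectorFlow v t p ∉ ω) :
    ∀ t ∈ Icc 0 R, X t = vectorFlow v t p := by
  obtain ⟨L, hL⟩ := hu.lipschitz
  have hvi : ∀ a b : ℝ, IntervalIntegrable (fun s => v (vectorFlow v s p)) volume a b := fun a b =>
    (hK.continuous.comp (continuous_vectorFlow hK hM p)).intervalIntegrable _ _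
  have hD : ∀ t, 0 ≤ t → X t - vectorFlow v t p = ∫ s in (0 : ℝ)..t,
      (v (X s) + ω.indicator (fun y => u y s) (X s) - v (vectorFlow v s p)) := fun t ht => by
    rw [intervalIntegral.integral_sub (hX t ht).1 (hvi _ _), (hX t ht).2,
      vectorFlow_eq_add_integral hK hM p t]
    abel
  intro t ht
  rw [← sub_eq_zero, hD t ht.1]
  refine integral_eq_zero_of_norm_le_mul_norm_integral (C := K + L) ((hX R hR).1.sub (hvi _ _))
    (fun s hs => ?_) t ht
  rw [← hD s hs.1.le]
  exact norm_controlled_sub_le hK hL (hfree s hs.1.le hs.2) s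

/-- A controlled trajectory that is at `q` at time `T` follows the free flow backward from `q` as
long as the latter avoids `ω`. -/
theorem IsControlledTrajectory.eq_vectorFlow_backward (hK : LipschitzWith K v)
    (hM : ∀ x, ‖v x‖ ≤ M) (hu : IsAdmissibleControl ω u) (hX : IsControlledTrajectory v ω u p X)
    {R T : ℝ} (hR : 0 ≤ R) (hRT : R ≤ T) {q : EuclideanSpace ℝ (Fin d)} (hq : X T = q)
    (hfree : ∀ t, 0 ≤ t → t < R → vectorFlow (-v) t q ∉ ω) :
    ∀ t ∈ Icc 0 R, X (T - t) = vectorFlow (-v) t q := by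
  obtain ⟨L, hL⟩ := hu.lipschitz
  have hT : 0 ≤ T := hR.trans hRT
  have hM' : ∀ x, ‖(-v) x‖ ≤ M := fun x => by simpa using hM x
  set w : ℝ → EuclideanSpace ℝ (Fin d) := fun s => v (X s) + ω.indicator (fun y => u y s) (X s)
  have hvi : ∀ a b : ℝ, IntervalIntegrable (fun s => v (vectorFlow (-v) s q)) volume a b :=
    fun a b => (hK.continuous.comp (continuous_vectorFlow hK.neg hM' q)).intervalIntegrable _ _
  have hwi : ∀ t ∈ Icc 0 T, IntervalIntegrable (fun s => w (T - s)) volume 0 t := fun t ht => by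
    have h1 : IntervalIntegrable w volume (T - 0) (T - t) :=
      (hX T hT).1.mono_set (by
        rw [uIcc_of_ge (by linarith [ht.1]), uIcc_of_le hT]
        exact Icc_subset_Icc (by linarith [ht.2]) (by linarith))
    simpa using h1.comp_sub_left T
  have hD : ∀ t ∈ Icc 0 T, X (T - t) - vectorFlow (-v) t q = ∫ s in (0 : ℝ)..t,
      (v (vectorFlow (-v) s q) - w (T - s)) := fun t ht => by
    rw [intervalIntegral.integral_sub (hvi _ _) (hwi t ht),
      intervalIntegral.integral_comp_sub_left w T, vectorFlow_eq_add_integral hK.neg hM' q t]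
    have h1 := (hX T hT).2
    have h2 := (hX (T - t) (by linarith [ht.2])).2
    have h3 := intervalIntegral.integral_add_adjacent_intervals (hX (T - t) (by linarith [ht.2])).1
      ((hX (T - t) (by linarith [ht.2])).1.symm.trans (hX T hT).1)
    rw [← h3] at h1
    simp only [Pi.neg_apply, intervalIntegral.integral_neg, sub_zero]
    rw [← hq, h1, h2]
    abel
  intro t ht
  rw [← sub_eq_zero, hD t ⟨ht.1, ht.2.trans hRT⟩]
  refine integral_eq_zero_of_norm_le_mul_norm_integral (C := K + L)
    ((hvi _ _).sub (hwi R ⟨hR, hRT⟩)) (fun s hs => ?_) t ht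
  rw [← hD s ⟨hs.1.le, hs.2.le.trans hRT⟩, norm_sub_rev]
  exact norm_controlled_sub_le hK hL (hfree s hs.1.le hs.2) (T - s)

end Uniqueness

/-! ### From disjoint curves to an admissible control -/

section Steering

/-- The fundamental theorem of calculus for Lipschitz curves. -/
theorem LipschitzWith.eq_add_integral_of_ae_hasDerivAt {E : Type*} [NormedAddCommGroup E]
    [NormedSpace ℝ E] [FiniteDimensional ℝ E] {x g : ℝ → E} {L : ℝ≥0} (hx : LipschitzWith L x)
    {a b : ℝ} (hg : ∀ᵐ s, s ∈ uIcc a b → HasDerivAt x (g s) s) :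
    IntervalIntegrable g volume a b ∧ x b = x a + ∫ s in a..b, g s := by
  borelize E
  have hbound : ∀ s, ‖deriv x s‖ ≤ L := fun s => norm_deriv_le_of_lipschitz hx
  have hint : ∀ a b, IntervalIntegrable (deriv x) volume a b := fun a b =>
    (intervalIntegrable_const (c := (L : ℝ))).mono_fun
      (measurable_deriv x).aestronglyMeasurable
      (Filter.Eventually.of_forall fun s => by simpa using hbound s)
  have heq : ∀ᵐ s, s ∈ uIoc a b → deriv x s = g s := by
    filter_upwards [hg] with s hs hsm
    exact (hs (uIoc_subset_uIcc hsm)).deriv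
  have hprim : LipschitzWith L (fun t => ∫ s in a..t, deriv x s) :=
    LipschitzWith.of_dist_le_mul fun s t => by
      rw [dist_eq_norm, intervalIntegral.integral_interval_sub_left (hint _ _) (hint _ _),
        Real.dist_eq]
      exact intervalIntegral.norm_integral_le_of_norm_le_const fun r _ => hbound r
  -- The curve minus the primitive of its derivative is absolutely continuous with derivative zero
  -- almost everywhere, hence constant.
  have hac : AbsolutelyContinuousOnInterval (fun t => x t - ∫ s in a..t, deriv x s) a b :=
    (hx.sub hprim).lipschitzOnWith.absolutelyContinuousOnInterval
  obtain ⟨C, hC⟩ := hac.const_of_ae_hasDerivAt_zero (by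
    filter_upwards [hx.ae_differentiableAt_real, (hint a b).ae_hasDerivAt_integral] with s h1 h2 h3
    have h4 := h1.hasDerivAt.sub (h2 h3 a left_mem_uIcc)
    rw [sub_self] at h4
    exact h4)
  have ha := hC a left_mem_uIcc
  have hb := hC b right_mem_uIcc
  refine ⟨(hint a b).congr_ae ((ae_restrict_iff' measurableSet_uIoc).2 heq), ?_⟩
  rw [← intervalIntegral.integral_congr_ae heq]
  simp only [intervalIntegral.integral_same, sub_zero] at ha
  rw [ha, ← hb]
  abel

/-- A Lipschitz curve that follows the vector field `v` outside of `K`. -/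
structure IsFreeOutside {E : Type*} [NormedAddCommGroup E] [NormedSpace ℝ E] (v : E → E)
    (K : Set E) (c : ℝ → E) : Prop where
  lipschitz : ∃ L : ℝ≥0, LipschitzWith L c
  hasDerivAt : ∀ t, c t ∉ K → HasDerivAt c (v (c t)) t

theorem IsFreeOutside.continuous {E : Type*} [NormedAddCommGroup E] [NormedSpace ℝ E] {v : E → E}
    {K : Set E} {c : ℝ → E} (hc : IsFreeOutside v K c) : Continuous c :=
  hc.lipschitz.choose_spec.continuous

theorem IsFreeOutside.mono {E : Type*} [NormedAddCommGroup E] [NormedSpace ℝ E] {v : E → E}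
    {K K' : Set E} {c : ℝ → E} (hc : IsFreeOutside v K c) (h : K ⊆ K') : IsFreeOutside v K' c :=
  ⟨hc.lipschitz, fun t ht => hc.hasDerivAt t fun hK => ht (h hK)⟩

/-- The tent function of radius `r`. -/
noncomputable def tent {E : Type*} [NormedAddCommGroup E] (r : ℝ) (z : E) : ℝ :=
  max 0 (1 - r⁻¹ * ‖z‖)

section Tent

variable {E : Type*} [NormedAddCommGroup E] {r : ℝ}

theorem tent_zero : tent r (0 : E) = 1 := by simp [tent]

theorem tent_nonneg (z : E) : 0 ≤ tent r z := le_max_left _ _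

theorem tent_le_one (hr : 0 < r) (z : E) : tent r z ≤ 1 :=
  max_le zero_le_one (by have : 0 ≤ r⁻¹ * ‖z‖ := by positivity
                         linarith)

theorem tent_eq_zero (hr : 0 < r) {z : E} (hz : r ≤ ‖z‖) : tent r z = 0 := by
  refine max_eq_left ?_
  have : r⁻¹ * r ≤ r⁻¹ * ‖z‖ := by gcongr
  rw [inv_mul_cancel₀ hr.ne'] at this
  linarith

theorem abs_tent_sub_tent_le (hr : 0 < r) (y z : E) : |tent r y - tent r z| ≤ r⁻¹ * ‖y - z‖ := by
  refine (abs_max_sub_max_le_max _ _ _ _).trans ?_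
  rw [sub_self, abs_zero]
  refine max_le (by positivity) ?_
  rw [show 1 - r⁻¹ * ‖y‖ - (1 - r⁻¹ * ‖z‖) = -(r⁻¹ * (‖y‖ - ‖z‖)) by ring, abs_neg, abs_mul,
    abs_of_pos (inv_pos.2 hr)]
  gcongr
  exact abs_norm_sub_norm_le y z

end Tent

variable {d n : ℕ} {v : EuclideanSpace ℝ (Fin d) → EuclideanSpace ℝ (Fin d)} {K : Set _}
  {ω : Set (EuclideanSpace ℝ (Fin d))} {y : Fin n → ℝ → EuclideanSpace ℝ (Fin d)}

/-- Pairwise distinct curves stay uniformly apart on a compact time interval. -/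
theorem exists_uniform_separation {E : Type*} [NormedAddCommGroup E] {y : Fin n → ℝ → E}
    (hy : ∀ i, Continuous (y i)) (T : ℝ) (hinj : ∀ t, Function.Injective fun i => y i t) :
    ∃ r > 0, ∀ i j, i ≠ j → ∀ t ∈ Icc 0 T, r ≤ ‖y i t - y j t‖ := by
  have key : ∀ q : Fin n × Fin n, ∃ r > 0, q.1 ≠ q.2 → ∀ t ∈ Icc 0 T,
      r ≤ ‖y q.1 t - y q.2 t‖ := by
    rintro ⟨i, j⟩
    by_cases hij : i = j
    · exact ⟨1, one_pos, fun h => absurd hij h⟩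
    have hpos : ∀ t ∈ Icc 0 T, 0 < ‖y i t - y j t‖ := fun t _ =>
      norm_pos_iff.2 (sub_ne_zero.2 fun h => hij (hinj t h))
    obtain ⟨r, hr, h⟩ := isCompact_Icc.exists_forall_le' (a := 0)
      ((hy i).sub (hy j)).norm.continuousOn hpos
    exact ⟨r, hr, fun _ => h⟩
  choose r hr h using key
  rcases isEmpty_or_nonempty (Fin n) with hE | hE
  · exact ⟨1, one_pos, fun i => hE.elim i⟩
  obtain ⟨q₀, hq₀⟩ := Finite.exists_min r
  exact ⟨r q₀, hr q₀, fun i j hij t ht => (hq₀ (i, j)).trans (h (i, j) hij t ht)⟩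

/-- A family of Lipschitz curves that never collide and follow `v` outside of a compact subset of
`ω` is realized by an admissible control. -/
theorem exactlyControllable_of_curves (hv : Continuous v) {M : ℝ≥0} (hM : ∀ x, ‖v x‖ ≤ M)
    (hω : IsOpen ω) (hKc : IsCompact K) (hK : K ⊆ ω) {T : ℝ≥0}
    {x₀ x₁ : Fin n → EuclideanSpace ℝ (Fin d)}
    (hy : ∀ i, IsFreeOutside v K (y i)) (hinj : ∀ t, Function.Injective fun i => y i t)
    (hend : ∀ t i, (T : ℝ) < t → HasDerivAt (y i) (v (y i t)) t)
    (h₀ : ∀ i, ∃ j, y i 0 = x₀ j) (h₁ : ∀ i, ∃ j, y i T = x₁ j) :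
    ExactlyControllable v ω x₀ x₁ T := by
  obtain ⟨r₁, hr₁, hsep⟩ := exists_uniform_separation (fun i => (hy i).continuous) T hinj
  obtain ⟨r₂, hr₂, hthick⟩ := hKc.exists_thickening_subset_open hω hK
  set r := min r₁ r₂ with hr_def
  have hr : 0 < r := lt_min hr₁ hr₂
  choose L hL using fun i => (hy i).lipschitz
  set A : Fin n → Set ℝ := fun i => Icc 0 (T : ℝ) ∩ y i ⁻¹' K with hA
  have hAm : ∀ i, MeasurableSet (A i) := fun i =>
    measurableSet_Icc.inter (hKc.isClosed.measurableSet.preimage (hy i).continuous.measurable)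
  -- The control needed along the `i`-th curve, cut off to the times in `[0, T]` at which that curve
  -- is in `K`; at all other times the curve is free.
  set w : Fin n → ℝ → EuclideanSpace ℝ (Fin d) := fun i =>
    (A i).indicator fun t => deriv (y i) t - v (y i t) with hw
  have hwm : ∀ i, Measurable (w i) := fun i =>
    ((measurable_deriv _).sub (hv.comp (hy i).continuous).measurable).indicator (hAm i)
  have hwb : ∀ i t, ‖w i t‖ ≤ L i + M := fun i t => by
    refine (norm_indicator_le_norm_self _ _).trans ((norm_sub_le _ _).trans ?_)
    exact add_le_add (norm_deriv_le_of_lipschitz (hL i)) (hM _)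
  -- The bound `r ≤ r₁` makes all tents but the `i`-th vanish at `y i t`, and `r ≤ r₂` keeps the
  -- active tents supported in `ω`.
  set u : EuclideanSpace ℝ (Fin d) → ℝ → EuclideanSpace ℝ (Fin d) := fun x t =>
    ∑ i, tent r (x - y i t) • w i t with hu
  have hu_out : ∀ x ∉ ω, ∀ t, u x t = 0 := fun x hx t => by
    refine Finset.sum_eq_zero fun i _ => ?_
    by_cases ht : t ∈ A i
    · rw [tent_eq_zero hr, zero_smul]
      by_contra! hlt
      refine hx (hthick (Metric.mem_thickening_iff.2 ⟨y i t, ht.2, ?_⟩))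
      rw [dist_eq_norm]
      exact hlt.trans_le (min_le_right _ _)
    · rw [hw]
      simp [indicator_of_notMem ht]
  have hind : ∀ t, (ω.indicator fun x => u x t) = fun x => u x t := fun t => by
    refine indicator_eq_self.2 fun x hx => ?_
    by_contra hxω
    exact hx (hu_out x hxω t)
  have hu_self : ∀ i, ∀ t ∈ Icc 0 (T : ℝ), u (y i t) t = w i t := fun i t ht => by
    simp only [hu]
    rw [Finset.sum_eq_single i]
    · rw [sub_self, tent_zero, one_smul]
    · intro j _ hj
      rw [tent_eq_zero hr ((min_le_left _ _).trans (hsep i j hj.symm t ht)), zero_smul]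
    · simp
  have hu_late : ∀ x t, (T : ℝ) < t → u x t = 0 := fun x t ht => by
    refine Finset.sum_eq_zero fun i _ => ?_
    have : t ∉ A i := fun h => absurd h.1.2 (not_le.2 ht)
    rw [hw]
    simp [indicator_of_notMem this]
  have hadm : IsAdmissibleControl ω u := by
    refine ⟨⟨∑ i, Real.toNNReal r⁻¹ * (L i + M), fun t => ?_⟩, fun x => ?_, ⟨∑ i, (L i + M), ?_⟩⟩
    · rw [hind]
      refine LipschitzWith.of_dist_le_mul fun x z => ?_
      rw [dist_eq_norm, dist_eq_norm]
      simp only [hu]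
      rw [← Finset.sum_sub_distrib, NNReal.coe_sum, Finset.sum_mul]
      refine (norm_sum_le _ _).trans (Finset.sum_le_sum fun i _ => ?_)
      rw [← sub_smul, norm_smul, Real.norm_eq_abs]
      have h1 := abs_tent_sub_tent_le hr (x - y i t) (z - y i t)
      rw [sub_sub_sub_cancel_right] at h1
      push_cast
      rw [Real.coe_toNNReal _ (inv_pos.2 hr).le]
      calc _ ≤ (r⁻¹ * ‖x - z‖) * (L i + M) :=
            mul_le_mul h1 (hwb i t) (norm_nonneg _) (by positivity)
        _ = _ := by ring
    · have : (fun t => ω.indicator (fun y => u y t) x) = fun t => u x t := by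
        funext t
        exact congrFun (hind t) x
      rw [this]
      refine Finset.measurable_fun_sum _ fun i _ => ?_
      have : Continuous fun t => tent r (x - y i t) :=
        continuous_const.max (continuous_const.sub (continuous_const.mul
          (continuous_const.sub (hy i).continuous).norm))
      exact this.measurable.smul (hwm i)
    · intro x t
      rw [congrFun (hind t) x, NNReal.coe_sum]
      refine (norm_sum_le _ _).trans (Finset.sum_le_sum fun i _ => ?_)
      rw [norm_smul, Real.norm_of_nonneg (tent_nonneg _)]
      push_cast
      calc _ ≤ 1 * (L i + M : ℝ) :=
            mul_le_mul (tent_le_one hr _) (hwb i t) (norm_nonneg _) zero_le_one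
        _ = _ := one_mul _
  choose ρ hρ using h₀
  choose σ hσ using h₁
  have hρi : Function.Injective ρ := fun i j hij => hinj 0 (by
    change y i 0 = y j 0
    rw [hρ, hρ, hij])
  have hσi : Function.Injective σ := fun i j hij => hinj T (by
    change y i T = y j T
    rw [hσ, hσ, hij])
  set ρe := Equiv.ofBijective ρ (Finite.injective_iff_bijective.1 hρi)
  set σe := Equiv.ofBijective σ (Finite.injective_iff_bijective.1 hσi)
  refine ⟨u, hadm, fun i => y (ρe.symm i), fun i t ht => ?_, ρe.symm.trans σe, fun i => hσ _⟩
  have h0 : x₀ i = y (ρe.symm i) 0 := by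
    rw [hρ]
    exact congrArg x₀ (ρe.apply_symm_apply i).symm
  rw [h0]
  beta_reduce
  generalize ρe.symm i = k
  refine (hL k).eq_add_integral_of_ae_hasDerivAt (a := 0) (b := t) ?_
  filter_upwards [(hL k).ae_differentiableAt_real] with s hs hst
  rw [uIcc_of_le ht] at hst
  rw [congrFun (hind s) (y k s)]
  rcases lt_or_ge (T : ℝ) s with hTs | hTs
  · rw [hu_late _ _ hTs, add_zero]
    exact hend s k hTs
  rw [hu_self k s ⟨hst.1, hTs⟩]
  by_cases hsK : y k s ∈ K
  · have : s ∈ A k := ⟨⟨hst.1, hTs⟩, hsK⟩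
    simp only [hw]
    rw [indicator_of_mem this]
    simpa using hs.hasDerivAt
  · have : s ∉ A k := fun h => hsK h.2
    simp only [hw]
    rw [indicator_of_notMem this, add_zero]
    exact (hy k).hasDerivAt s hsK

end Steering

/-! ### Lipschitz bridges inside `ω` -/

section Bridge

/-- In an open connected set any two points are joined by a Lipschitz path. -/
theorem IsPreconnected.exists_lipschitz_path {E : Type*} [NormedAddCommGroup E] [NormedSpace ℝ E]
    {ω : Set E} (hconn : IsPreconnected ω) (hω : IsOpen ω) {x y : E} (hx : x ∈ ω) (hy : y ∈ ω) :
    ∃ γ : ℝ → E, (∃ L : ℝ≥0, LipschitzWith L γ) ∧ (∀ t ≤ 0, γ t = x) ∧ (∀ t, 1 ≤ t → γ t = y) ∧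
      ∀ t, γ t ∈ ω := by
  -- By connectedness it suffices to join nearby points, by a segment in a ball, and to concatenate
  -- paths.
  refine hconn.induction₂' (fun x y => ∃ γ : ℝ → E, (∃ L : ℝ≥0, LipschitzWith L γ) ∧
    (∀ t ≤ 0, γ t = x) ∧ (∀ t, 1 ≤ t → γ t = y) ∧ ∀ t, γ t ∈ ω) ?_ ?_ hx hy
  · intro x hx
    obtain ⟨r, hr, hball⟩ := Metric.isOpen_iff.1 hω x hx
    have key : ∀ p ∈ Metric.ball x r, ∀ q ∈ Metric.ball x r, ∃ γ : ℝ → E,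
        (∃ L : ℝ≥0, LipschitzWith L γ) ∧ (∀ t ≤ 0, γ t = p) ∧ (∀ t, 1 ≤ t → γ t = q) ∧
        ∀ t, γ t ∈ ω := by
      intro p hp q hq
      refine ⟨fun t => p + max 0 (min t 1) • (q - p), ⟨‖q - p‖₊, ?_⟩, fun t ht => ?_,
        fun t ht => ?_, fun t => hball ?_⟩
      · refine LipschitzWith.of_dist_le_mul fun s t => ?_
        rw [dist_eq_norm, add_sub_add_left_eq_sub, ← sub_smul, norm_smul, mul_comm, coe_nnnorm]
        gcongr
        have h := ((LipschitzWith.id (α := ℝ)).min_const 1).const_max 0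
        simpa [Real.norm_eq_abs, Real.dist_eq] using h.dist_le_mul s t
      · have : max 0 (min t 1) = (0 : ℝ) := max_eq_left ((min_le_left _ _).trans ht)
        simp [this]
      · have : max 0 (min t 1) = (1 : ℝ) := by rw [min_eq_right ht]; exact max_eq_right zero_le_one
        simp [this]
      · exact (convex_ball x r).add_smul_sub_mem hp hq
          ⟨le_max_left _ _, max_le zero_le_one (min_le_right _ _)⟩
    filter_upwards [self_mem_nhdsWithin, mem_nhdsWithin_of_mem_nhds (Metric.ball_mem_nhds x hr)]
      with y _ hyb
    exact ⟨key x (Metric.mem_ball_self hr) y hyb, key y hyb x (Metric.mem_ball_self hr)⟩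
  · rintro x y z - - - ⟨γ, ⟨L, hL⟩, h0, h1, hγ⟩ ⟨η, ⟨L', hL'⟩, h0', h1', hη⟩
    have e1 : LipschitzWith 2 (fun t : ℝ => 2 * t) := LipschitzWith.of_dist_le_mul fun s t => by
      rw [Real.dist_eq, Real.dist_eq, ← mul_sub, abs_mul]; simp
    have e2 : LipschitzWith 2 (fun t : ℝ => 2 * t - 1) := LipschitzWith.of_dist_le_mul fun s t => by
      rw [Real.dist_eq, Real.dist_eq, show 2 * s - 1 - (2 * t - 1) = 2 * (s - t) by ring, abs_mul]
      simp
    -- Each path is constant while the other one moves, so concatenation is a sum and its Lipschitz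
    -- bound needs no case distinction.
    refine ⟨fun t => γ (2 * t) + (η (2 * t - 1) - y),
      ⟨_, (hL.comp e1).add ((hL'.comp e2).sub (LipschitzWith.const y))⟩,
      fun t ht => ?_, fun t ht => ?_, fun t => ?_⟩
    · beta_reduce
      rw [h0 _ (by linarith), h0' _ (by linarith)]; abel
    · beta_reduce
      rw [h1 _ (by linarith), h1' _ (by linarith)]; abel
    · beta_reduce
      rcases le_total (2 * t) 1 with h | h
      · rw [h0' _ (by linarith), sub_self, add_zero]; exact hγ _
      · rw [h1 _ h, add_sub_cancel]; exact hη _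

variable {E : Type*} [NormedAddCommGroup E] [NormedSpace ℝ E] {v : E → E} {ω : Set E}

/-- Two integral curves of `v`, one until time `a` and the other from time `b > a` on, are joined
by a curve inside `ω`. -/
theorem exists_bridge (hconn : IsPreconnected ω) (hω : IsOpen ω) {f g : ℝ → E} {L L' : ℝ≥0}
    (hfL : LipschitzWith L f) (hgL : LipschitzWith L' g) (hf : ∀ t, HasDerivAt f (v (f t)) t)
    (hg : ∀ t, HasDerivAt g (v (g t)) t) {a b : ℝ} (hab : a < b) (ha : f a ∈ ω) (hb : g b ∈ ω) :
    ∃ (K : Set E) (c : ℝ → E), IsCompact K ∧ K ⊆ ω ∧ IsFreeOutside v K c ∧ (∀ t ≤ a, c t = f t) ∧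
      (∀ t, b ≤ t → c t = g t) ∧ ∀ t ∈ Icc a b, c t ∈ K := by
  obtain ⟨γ, ⟨Lγ, hLγ⟩, h0, h1, hγ⟩ := hconn.exists_lipschitz_path hω ha hb
  have hba : 0 < b - a := sub_pos.2 hab
  have hscale : LipschitzWith (Real.toNNReal (b - a)⁻¹) (fun t : ℝ => (b - a)⁻¹ * (t - a)) :=
    LipschitzWith.of_dist_le_mul fun s t => by
      rw [Real.coe_toNNReal _ (inv_pos.2 hba).le, Real.dist_eq, Real.dist_eq, ← mul_sub, abs_mul,
        abs_of_pos (inv_pos.2 hba), sub_sub_sub_cancel_right]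
  -- Again a sum of three curves of which at most one moves at a time: `f` until `a`, the path in
  -- `ω` on `[a, b]`, then `g`.
  set c : ℝ → E := fun t => f (min t a) + (γ ((b - a)⁻¹ * (t - a)) - f a) + (g (max t b) - g b)
    with hc
  have hbefore : ∀ t ≤ a, c t = f t := fun t ht => by
    simp only [hc]
    rw [min_eq_left ht, max_eq_right (ht.trans hab.le),
      h0 _ (mul_nonpos_of_nonneg_of_nonpos (inv_pos.2 hba).le (by linarith))]
    abel
  have hmid : ∀ t ∈ Icc a b, c t = γ ((b - a)⁻¹ * (t - a)) := fun t ht => by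
    simp only [hc]
    rw [min_eq_right ht.1, max_eq_right ht.2]
    abel
  have hafter : ∀ t, b ≤ t → c t = g t := fun t ht => by
    simp only [hc]
    rw [min_eq_right (hab.le.trans ht), max_eq_left ht, h1]
    · abel
    · rw [inv_mul_eq_div, one_le_div hba]
      linarith
  have hcL : ∃ L : ℝ≥0, LipschitzWith L c :=
    ⟨_, ((hfL.comp (LipschitzWith.id.min_const a)).add
      ((hLγ.comp hscale).sub (LipschitzWith.const (f a)))).add
      ((hgL.comp (LipschitzWith.id.max_const b)).sub (LipschitzWith.const (g b)))⟩
  have hcc : Continuous c := hcL.choose_spec.continuous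
  refine ⟨c '' Icc a b, c, isCompact_Icc.image hcc, ?_, ⟨hcL, fun t ht => ?_⟩, hbefore, hafter,
    fun t ht => mem_image_of_mem c ht⟩
  · rintro _ ⟨t, ht, rfl⟩
    rw [hmid t ht]
    exact hγ _
  · rcases lt_or_ge t a with hta | hta
    · rw [hbefore t hta.le]
      refine (hf t).congr_of_eventuallyEq ?_
      filter_upwards [eventually_lt_nhds hta] with s hs using hbefore s hs.le
    rcases lt_or_ge b t with htb | htb
    · rw [hafter t htb.le]
      refine (hg t).congr_of_eventuallyEq ?_
      filter_upwards [eventually_gt_nhds htb] with s hs using hafter s hs.le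
    · exact absurd (mem_image_of_mem c (show t ∈ Icc a b from ⟨hta, htb⟩)) ht

end Bridge

/-- A family of Lipschitz curves following `v` outside of a compact subset `K` of `ω`, and also
after time `T`, that collide only inside `K` and at times in `(0, T)`. -/
structure IsSteeringFamily {E : Type*} [NormedAddCommGroup E] [NormedSpace ℝ E] {n : ℕ}
    (v : E → E) (ω : Set E) (T : ℝ) (K : Set E) (c : Fin n → ℝ → E) : Prop where
  nonempty : K.Nonempty
  isCompact : IsCompact K
  subset : K ⊆ ω
  free : ∀ i, IsFreeOutside v K (c i)
  late : ∀ i t, T < t → HasDerivAt (c i) (v (c i t)) t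
  collide : ∀ i j, i ≠ j → ∀ t, c i t = c j t → c i t ∈ K ∧ t ∈ Ioo 0 T

/-! ### Joining the configurations, with collisions confined to `ω` -/

section Base

variable {d n : ℕ} {v : EuclideanSpace ℝ (Fin d) → EuclideanSpace ℝ (Fin d)} {L M : ℝ≥0}
  {ω : Set (EuclideanSpace ℝ (Fin d))} {x₀ x₁ : Fin n → EuclideanSpace ℝ (Fin d)}

/-- Two initial free pieces, or two final ones, never meet, because the flow is injective. If an
initial piece meets a final one, the free flow carries `x₀ i` to `x₁ (σ j)`; then `α i + β (σ j) <
T`, and the two pieces are too short to share a time. Thus any collision involves a bridge, which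
lies in `K`. -/
theorem exists_isSteeringFamily (hL : LipschitzWith L v) (hM : ∀ x, ‖v x‖ ≤ M) (hω : IsOpen ω)
    (hconn : IsConnected ω) (hx₀ : Function.Injective x₀) (hx₁ : Function.Injective x₁)
    {α β : Fin n → ℝ} (hα : ∀ i, IsEntryTime v ω (x₀ i) (α i))
    (hβ : ∀ i, IsEntryTime (-v) ω (x₁ i) (β i)) {T : ℝ} (hαT : ∀ i, α i < T)
    {σ : Equiv.Perm (Fin n)} (hσ : ∀ i, α i + β (σ i) < T) :
    ∃ (K : Set (EuclideanSpace ℝ (Fin d))) (c : Fin n → ℝ → EuclideanSpace ℝ (Fin d)),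
      IsSteeringFamily v ω T K c ∧ (∀ i, c i 0 = x₀ i) ∧ ∀ i, c i T = x₁ (σ i) := by
  -- The margin must serve every pair with a strict inequality, not just those matched by `σ`: the
  -- exclusion of collisions uses pairs `(i, σ j)`.
  obtain ⟨ε, hε, hε0⟩ : ∃ ε : ℝ, (∀ i j, α i + β j < T → α i + β j + 2 * ε < T) ∧ 0 < ε := by
    have h : ∀ᶠ ε : ℝ in nhds 0, ∀ i j, α i + β j < T → α i + β j + 2 * ε < T := by
      refine Filter.eventually_all.2 fun i => Filter.eventually_all.2 fun j => ?_
      by_cases hij : α i + β j < T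
      · have hc : ContinuousAt (fun ε : ℝ => α i + β j + 2 * ε) 0 := by fun_prop
        filter_upwards [hc.eventually (eventually_lt_nhds (by simpa using hij))] with ε h _ using h
      · exact Filter.Eventually.of_forall fun _ h => absurd h hij
    exact ((h.filter_mono nhdsWithin_le_nhds).and (self_mem_nhdsWithin (s := Ioi (0 : ℝ)))).exists
  choose a haα haε ha using fun i => (hα i).exists_mem ε hε0
  choose b hbβ hbε hb using fun i => (hβ i).exists_mem ε hε0
  have hab : ∀ i, a i < T - b (σ i) := fun i => by
    linarith [hε i (σ i) (hσ i), haε i, hbε (σ i)]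
  have ha0 : ∀ i, 0 ≤ a i := fun i => (hα i).nonneg.trans (haα i)
  have hb0 : ∀ i, 0 ≤ b i := fun i => (hβ i).nonneg.trans (hbβ i)
  have hgd : ∀ i t, HasDerivAt (fun t => vectorFlow v (t - T) (x₁ i))
      (v (vectorFlow v (t - T) (x₁ i))) t := fun i t =>
    (hasDerivAt_vectorFlow hL hM (x₁ i) (t - T)).comp_sub_const t T
  have hgL : ∀ i, LipschitzWith (M * 1) (fun t => vectorFlow v (t - T) (x₁ i)) := fun i =>
    (lipschitzWith_vectorFlow hL hM (x₁ i)).comp (LipschitzWith.of_dist_le_mul fun s t => by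
      simp [Real.dist_eq])
  choose K c hKc hKω hfree hbefore hafter hmid using fun i =>
    exists_bridge hconn.isPreconnected hω (lipschitzWith_vectorFlow hL hM (x₀ i)) (hgL (σ i))
      (hasDerivAt_vectorFlow hL hM (x₀ i)) (hgd (σ i)) (hab i) (ha i) (by
        have : T - b (σ i) - T = -b (σ i) := by ring
        rw [this, vectorFlow_neg_time hL hM]
        exact hb (σ i))
  -- The point `z` keeps the compact set non-empty even when there are no curves, as the arguments
  -- with distances to it require.
  obtain ⟨z, hz⟩ := hconn.nonempty
  have hsub : ∀ i, K i ⊆ {z} ∪ ⋃ i, K i := fun i =>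
    (subset_iUnion K i).trans subset_union_right
  refine ⟨{z} ∪ ⋃ i, K i, c, ⟨⟨z, Or.inl rfl⟩, isCompact_singleton.union (isCompact_iUnion hKc),
    union_subset (singleton_subset_iff.2 hz) (iUnion_subset hKω), fun i => (hfree i).mono (hsub i),
    fun i t ht => ?_, fun i j hij t hcol => ?_⟩, fun i => ?_, fun i => ?_⟩
  · have := hgd (σ i) t
    rw [hafter i t (by linarith [hb0 (σ i)])]
    refine this.congr_of_eventuallyEq ?_
    filter_upwards [eventually_gt_nhds ht] with s hs using hafter i s (by linarith [hb0 (σ i)])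
  · have hff : ¬ (t ≤ a i ∧ t ≤ a j) := fun ⟨h1, h2⟩ => by
      rw [hbefore i t h1, hbefore j t h2] at hcol
      exact hij (hx₀ (vectorFlow_injective hL hM t hcol))
    have hgg : ¬ (T - b (σ i) ≤ t ∧ T - b (σ j) ≤ t) := fun ⟨h1, h2⟩ => by
      rw [hafter i t h1, hafter j t h2] at hcol
      exact hij (σ.injective (hx₁ (vectorFlow_injective hL hM _ hcol)))
    have hfg : ∀ i j, c i t = c j t → ¬ (t ≤ a i ∧ T - b (σ j) ≤ t) := fun i j hcol ⟨h1, h2⟩ => by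
      rw [hbefore i t h1, hafter j t h2] at hcol
      have hflow : vectorFlow v T (x₀ i) = x₁ (σ j) := by
        rw [show T = -(t - T) + t by ring, vectorFlow_add hL hM, hcol,
          vectorFlow_neg_vectorFlow hL hM]
      have h := (hα i).add_lt_of_vectorFlow_eq hL hM hω (hβ (σ j)) (hαT i) hflow
      linarith [hε i (σ j) h, haε i, hbε (σ j)]
    have h1 := hfg i j hcol
    have h2 := hfg j i hcol.symm
    refine ⟨?_, ?_, ?_⟩
    · by_cases hi : t ∈ Icc (a i) (T - b (σ i))
      · exact hsub i (hmid i t hi)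
      by_cases hj : t ∈ Icc (a j) (T - b (σ j))
      · rw [hcol]
        exact hsub j (hmid j t hj)
      simp only [mem_Icc, not_and_or, not_le] at hi hj
      rcases hi with hi | hi <;> rcases hj with hj | hj
      · exact absurd ⟨hi.le, hj.le⟩ hff
      · exact absurd ⟨hi.le, hj.le⟩ h1
      · exact absurd ⟨hj.le, hi.le⟩ h2
      · exact absurd ⟨hi.le, hj.le⟩ hgg
    · by_contra! h
      exact hff ⟨h.trans (ha0 i), h.trans (ha0 j)⟩
    · by_contra! h
      exact hgg ⟨by linarith [hb0 (σ i)], by linarith [hb0 (σ j)]⟩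
  · rw [hbefore i 0 (ha0 i), vectorFlow_zero hL hM]
  · rw [hafter i T (by linarith [hb0 (σ i)]), sub_self, vectorFlow_zero hL hM]

end Base

/-! ### Localized shifts of curves -/

section Spread

variable {E : Type*} [NormedAddCommGroup E] {K : Set E} {ρ T : ℝ}

/-- A weight that is positive at times in `(0, T)` on the `ρ`-neighbourhood of `K`, and zero
otherwise. -/
noncomputable def spreadWeight (K : Set E) (ρ T t : ℝ) (x : E) : ℝ :=
  max 0 (min 1 (min t (T - t))) * max 0 (ρ - Metric.infDist x K)

theorem spreadWeight_nonneg (t : ℝ) (x : E) : 0 ≤ spreadWeight K ρ T t x :=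
  mul_nonneg (le_max_left _ _) (le_max_left _ _)

theorem spreadWeight_le (hρ : 0 ≤ ρ) (t : ℝ) (x : E) : spreadWeight K ρ T t x ≤ ρ := by
  have h1 : max 0 (min 1 (min t (T - t))) ≤ 1 := max_le zero_le_one (min_le_left _ _)
  have h2 : max 0 (ρ - Metric.infDist x K) ≤ ρ :=
    max_le hρ (by linarith [Metric.infDist_nonneg (x := x) (s := K)])
  calc _ ≤ 1 * ρ := mul_le_mul h1 h2 (le_max_left _ _) zero_le_one
    _ = ρ := one_mul ρ

theorem spreadWeight_eq_zero_of_notMem_Ioo {t : ℝ} (ht : t ∉ Ioo 0 T) (x : E) :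
    spreadWeight K ρ T t x = 0 := by
  rw [spreadWeight, max_eq_left, zero_mul]
  by_contra! h
  rw [lt_min_iff, lt_min_iff] at h
  exact ht ⟨h.2.1, by linarith [h.2.2]⟩

theorem spreadWeight_eq_zero_of_le {x : E} (hx : ρ ≤ Metric.infDist x K) (t : ℝ) :
    spreadWeight K ρ T t x = 0 := by
  rw [spreadWeight, max_eq_left (b := ρ - _) (by linarith), mul_zero]

theorem spreadWeight_pos (hρ : 0 < ρ) {t : ℝ} (ht : t ∈ Ioo 0 T) {x : E} (hx : x ∈ K) :
    0 < spreadWeight K ρ T t x := by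
  refine mul_pos (lt_max_of_lt_right ?_) (lt_max_of_lt_right ?_)
  · exact lt_min one_pos (lt_min ht.1 (by linarith [ht.2]))
  · rwa [Metric.infDist_zero_of_mem hx, sub_zero]

/-- The constant 1 matters: on the line, shifts by factors below 1 then preserve strict order. -/
theorem abs_spreadWeight_sub_le (t : ℝ) (x y : E) :
    |spreadWeight K ρ T t x - spreadWeight K ρ T t y| ≤ ‖x - y‖ := by
  have h1 : max 0 (min 1 (min t (T - t))) ≤ 1 := max_le zero_le_one (min_le_left _ _)
  have h2 : |max 0 (ρ - Metric.infDist x K) - max 0 (ρ - Metric.infDist y K)| ≤ ‖x - y‖ := by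
    have := (((LipschitzWith.const ρ).sub (Metric.lipschitz_infDist_pt K)).const_max 0).dist_le_mul
      x y
    simpa [Real.dist_eq, dist_eq_norm] using this
  rw [spreadWeight, spreadWeight, ← mul_sub, abs_mul, abs_of_nonneg (le_max_left _ _)]
  calc _ ≤ 1 * ‖x - y‖ := mul_le_mul h1 h2 (abs_nonneg _) zero_le_one
    _ = _ := one_mul _

theorem abs_spreadWeight_sub_le_time (hρ : 0 ≤ ρ) (s t : ℝ) (x : E) :
    |spreadWeight K ρ T s x - spreadWeight K ρ T t x| ≤ ρ * |s - t| := by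
  have h1 : |max 0 (min 1 (min s (T - s))) - max 0 (min 1 (min t (T - t)))| ≤ |s - t| := by
    have := (((LipschitzWith.id (α := ℝ)).min
      ((LipschitzWith.const T).sub LipschitzWith.id)).const_min 1 |>.const_max 0).dist_le_mul s t
    simpa [Real.dist_eq] using this
  have h2 : max 0 (ρ - Metric.infDist x K) ≤ ρ :=
    max_le hρ (by linarith [Metric.infDist_nonneg (x := x) (s := K)])
  rw [spreadWeight, spreadWeight, ← sub_mul, abs_mul,
    abs_of_nonneg (le_max_left 0 (ρ - Metric.infDist x K)), mul_comm]
  exact mul_le_mul h2 h1 (abs_nonneg _) hρ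

theorem lipschitzWith_spreadWeight (hρ : 0 ≤ ρ) {c : ℝ → E} {L : ℝ≥0} (hc : LipschitzWith L c) :
    ∃ L' : ℝ≥0, LipschitzWith L' fun t => spreadWeight K ρ T t (c t) := by
  refine ⟨L + ρ.toNNReal, LipschitzWith.of_dist_le_mul fun s t => ?_⟩
  rw [Real.dist_eq, Real.dist_eq]
  have h1 := abs_spreadWeight_sub_le (K := K) (ρ := ρ) (T := T) s (c s) (c t)
  have h2 := abs_spreadWeight_sub_le_time (K := K) (T := T) hρ s t (c t)
  have h3 := hc.dist_le_mul s t
  rw [dist_eq_norm, Real.dist_eq] at h3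
  push_cast
  rw [Real.coe_toNNReal _ hρ, add_mul]
  exact (abs_sub_le _ _ _).trans (add_le_add (h1.trans h3) h2)

/-- Shifting a curve in direction `θ`, near `K` and at times in `(0, T)` only. -/
noncomputable def spread (K : Set E) [NormedSpace ℝ E] (ρ T : ℝ) (θ : E) (c : ℝ → E) (t : ℝ) : E :=
  c t + spreadWeight K ρ T t (c t) • θ

variable [NormedSpace ℝ E] {θ : E} {c : ℝ → E}

theorem spread_eq_self_of_notMem_Ioo {t : ℝ} (ht : t ∉ Ioo 0 T) : spread K ρ T θ c t = c t := by
  rw [spread, spreadWeight_eq_zero_of_notMem_Ioo ht, zero_smul, add_zero]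

/-- Only points within `ρ` of `K` are moved, and by at most `ρ`, so a moved point stays within `2 *
ρ` of `K`. -/
theorem spread_eq_self_of_notMem (hK : K.Nonempty) (hρ : 0 ≤ ρ) (hθ : ‖θ‖ ≤ 1) {t : ℝ}
    (ht : spread K ρ T θ c t ∉ Metric.cthickening (2 * ρ) K) : spread K ρ T θ c t = c t := by
  rcases le_or_gt ρ (Metric.infDist (c t) K) with h | h
  · rw [spread, spreadWeight_eq_zero_of_le h, zero_smul, add_zero]
  refine absurd ?_ ht
  refine Metric.thickening_subset_cthickening _ _
    ((Metric.mem_thickening_iff_infDist_lt hK).2 ?_)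
  have h1 := Metric.infDist_le_infDist_add_dist (s := K) (x := spread K ρ T θ c t) (y := c t)
  have h2 : dist (spread K ρ T θ c t) (c t) ≤ ρ := by
    rw [dist_eq_norm, spread, add_sub_cancel_left, norm_smul,
      Real.norm_of_nonneg (spreadWeight_nonneg _ _)]
    calc _ ≤ ρ * 1 := mul_le_mul (spreadWeight_le hρ _ _) hθ (norm_nonneg _) hρ
      _ = ρ := mul_one ρ
  linarith

theorem IsFreeOutside.spread {v : E → E} (hc : IsFreeOutside v K c) (hK : K.Nonempty) (hρ : 0 < ρ)
    (hθ : ‖θ‖ ≤ 1) : IsFreeOutside v (Metric.cthickening (2 * ρ) K) (spread K ρ T θ c) := by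
  obtain ⟨L, hL⟩ := hc.lipschitz
  obtain ⟨L', hL'⟩ := lipschitzWith_spreadWeight (K := K) (T := T) hρ.le hL
  have hlip : LipschitzWith (L + L') (_root_.spread K ρ T θ c) := by
    refine LipschitzWith.of_dist_le_mul fun s t => ?_
    have h1 := hL.dist_le_mul s t
    have h2 := hL'.dist_le_mul s t
    rw [dist_eq_norm] at h1 h2 ⊢
    rw [_root_.spread, _root_.spread, add_sub_add_comm, ← sub_smul]
    refine (norm_add_le _ _).trans ?_
    rw [norm_smul]
    push_cast
    rw [add_mul]
    refine add_le_add h1 ?_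
    calc _ ≤ L' * dist s t * 1 := mul_le_mul h2 hθ (norm_nonneg _) (by positivity)
      _ = _ := mul_one _
  refine ⟨⟨_, hlip⟩, fun t ht => ?_⟩
  have hev : ∀ᶠ s in nhds t, _root_.spread K ρ T θ c s ∉ Metric.cthickening (2 * ρ) K :=
    hlip.continuous.continuousAt.eventually
      (Metric.isClosed_cthickening.isOpen_compl.mem_nhds ht)
  have heq := spread_eq_self_of_notMem hK hρ.le hθ ht
  rw [heq] at ht ⊢
  refine (hc.hasDerivAt t fun h => ht (Metric.self_subset_cthickening _ h)).congr_of_eventuallyEq ?_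
  filter_upwards [hev] with s hs using spread_eq_self_of_notMem hK hρ.le hθ hs

theorem hasDerivAt_spread_of_late {v : E → E} {t : ℝ} (ht : T < t) (hc : HasDerivAt c (v (c t)) t) :
    HasDerivAt (spread K ρ T θ c) (v (spread K ρ T θ c t)) t := by
  rw [spread_eq_self_of_notMem_Ioo fun h => absurd h.2 (not_lt.2 ht.le)]
  refine hc.congr_of_eventuallyEq ?_
  filter_upwards [eventually_gt_nhds ht] with s hs
  exact spread_eq_self_of_notMem_Ioo fun h => absurd h.2 (not_lt.2 hs.le)

theorem IsSteeringFamily.exists_cthickening [ProperSpace E] {v : E → E} {ω : Set E} {n : ℕ}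
    {c : Fin n → ℝ → E} (hc : IsSteeringFamily v ω T K c) (hω : IsOpen ω) :
    ∃ ρ > 0, IsCompact (Metric.cthickening (2 * ρ) K) ∧ Metric.cthickening (2 * ρ) K ⊆ ω := by
  obtain ⟨δ, hδ, h⟩ := hc.isCompact.exists_cthickening_subset_open hω hc.subset
  refine ⟨δ / 2, half_pos hδ, hc.isCompact.cthickening, ?_⟩
  rwa [mul_div_cancel₀ _ two_ne_zero]

end Spread

/-! ### Removing collisions in dimension at least two -/

section Generic

variable {E : Type*} [NormedAddCommGroup E] [NormedSpace ℝ E] {v : E → E} {ω K : Set E} {T : ℝ}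
  {n : ℕ} {c : Fin n → ℝ → E}

/-- A Lipschitz curve divided by a Lipschitz function has dimension at most one. -/
theorem dimH_image_inv_smul_le {s : ℝ → ℝ} {f : ℝ → E} {L L' : ℝ≥0} (hs : LipschitzWith L s)
    (hf : LipschitzWith L' f) : dimH ((fun t => (s t)⁻¹ • f t) '' {t | s t ≠ 0}) ≤ 1 := by
  refine (dimH_image_le_of_locally_lipschitzOn fun t ht => ?_).trans
    ((dimH_mono (subset_univ _)).trans Real.dimH_univ.le)
  have hcd : ContDiffAt ℝ 1 (fun q : ℝ × E => q.1⁻¹ • q.2) (s t, f t) :=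
    (contDiffAt_fst.inv (show (s t, f t).1 ≠ 0 from ht)).smul contDiffAt_snd
  obtain ⟨C, U, hU, hC⟩ := hcd.exists_lipschitzOnWith
  have hpair : LipschitzWith (max L L') fun t => (s t, f t) := hs.prodMk hf
  refine ⟨C * max L L', (fun t => (s t, f t)) ⁻¹' U,
    mem_nhdsWithin_of_mem_nhds (hpair.continuous.continuousAt hU), ?_⟩
  exact hC.comp hpair.lipschitzOnWith (mapsTo_preimage _ _)

variable [FiniteDimensional ℝ E]

/-- In dimension at least two, one curve of a family can be perturbed to avoid all others. -/
theorem IsSteeringFamily.exists_update (hdim : 2 ≤ Module.finrank ℝ E)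
    (hc : IsSteeringFamily v ω T K c) (hω : IsOpen ω) (i : Fin n) :
    ∃ (K' : Set E) (γ : ℝ → E), IsSteeringFamily v ω T K' (Function.update c i γ) ∧
      γ 0 = c i 0 ∧ γ T = c i T ∧ ∀ j ≠ i, ∀ t, γ t ≠ c j t := by
  have : ProperSpace E := FiniteDimensional.proper ℝ E
  obtain ⟨ρ, hρ, hcomp, hsub⟩ := hc.exists_cthickening hω
  set s : ℝ → ℝ := fun t => spreadWeight K ρ T t (c i t)
  choose L hL using fun i => (hc.free i).lipschitz
  obtain ⟨L', hL'⟩ : ∃ L', LipschitzWith L' s := lipschitzWith_spreadWeight hρ.le (hL i)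
  -- At a time with `s t ≠ 0`, the shifted curve meets `c j` only if `θ` is the quotient listed
  -- here. Where `s t = 0` the curve is unmoved, and `collide` excludes a meeting because the weight
  -- is positive on `K` at times in `(0, T)`.
  set B : Set E := ⋃ j, (fun t => (s t)⁻¹ • (c j t - c i t)) '' {t | s t ≠ 0} with hB
  have hBdim : dimH B < Module.finrank ℝ E := by
    rw [hB, dimH_iUnion]
    refine (iSup_le fun j => dimH_image_inv_smul_le hL' ((hL j).sub (hL i))).trans_lt ?_
    exact_mod_cast hdim
  obtain ⟨θ, hθB, hθ⟩ := (dense_compl_of_dimH_lt_finrank hBdim).exists_mem_open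
    (Metric.isOpen_ball (x := (0 : E)) (ε := 1)) ⟨0, Metric.mem_ball_self one_pos⟩
  have hθ1 : ‖θ‖ ≤ 1 := (mem_ball_zero_iff.1 hθ).le
  have havoid : ∀ j ≠ i, ∀ t, spread K ρ T θ (c i) t ≠ c j t := by
    intro j hj t heq
    by_cases hst : s t = 0
    · have h1 : c i t = c j t := by
        rw [← heq, spread]
        change c i t = c i t + s t • θ
        rw [hst, zero_smul, add_zero]
      obtain ⟨h2, h3⟩ := hc.collide i j hj.symm t h1
      exact (spreadWeight_pos hρ h3 h2).ne' hst
    · refine hθB (mem_iUnion.2 ⟨j, t, hst, ?_⟩)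
      simp only
      rw [← heq, spread, add_sub_cancel_left]
      exact inv_smul_smul₀ hst θ
  refine ⟨Metric.cthickening (2 * ρ) K, spread K ρ T θ (c i),
    ⟨hc.nonempty.mono (Metric.self_subset_cthickening _), hcomp, hsub, fun j => ?_, fun j t ht => ?_,
      fun j k hjk t hcol => ?_⟩, spread_eq_self_of_notMem_Ioo fun h => lt_irrefl _ h.1,
    spread_eq_self_of_notMem_Ioo fun h => lt_irrefl _ h.2, havoid⟩
  · rcases eq_or_ne j i with rfl | hj
    · rw [Function.update_self]
      exact (hc.free j).spread hc.nonempty hρ hθ1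
    · rw [Function.update_of_ne hj]
      exact (hc.free j).mono (Metric.self_subset_cthickening _)
  · rcases eq_or_ne j i with rfl | hj
    · rw [Function.update_self]
      exact hasDerivAt_spread_of_late ht (hc.late j t ht)
    · rw [Function.update_of_ne hj]
      exact hc.late j t ht
  · rcases eq_or_ne j i with rfl | hj
    · rw [Function.update_self, Function.update_of_ne hjk.symm] at hcol
      exact absurd hcol (havoid k hjk.symm t)
    rcases eq_or_ne k i with rfl | hk
    · rw [Function.update_self, Function.update_of_ne hj] at hcol
      exact absurd hcol.symm (havoid j hj t)
    rw [Function.update_of_ne hj, Function.update_of_ne hk] at hcol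
    rw [Function.update_of_ne hj]
    exact (hc.collide j k hjk t hcol).imp (fun h => Metric.self_subset_cthickening _ h) id

/-- The curves are perturbed one at a time. A new perturbation avoids all other curves, so
separations already obtained survive. -/
theorem IsSteeringFamily.exists_injective_of_two_le_finrank (hdim : 2 ≤ Module.finrank ℝ E)
    (hc : IsSteeringFamily v ω T K c) (hω : IsOpen ω) :
    ∃ (K' : Set E) (y : Fin n → ℝ → E), IsSteeringFamily v ω T K' y ∧
      (∀ t, Function.Injective fun i => y i t) ∧ (∀ i, y i 0 = c i 0) ∧ ∀ i, y i T = c i T := by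
  have key : ∀ A : Finset (Fin n), ∃ (K' : Set E) (y : Fin n → ℝ → E),
      IsSteeringFamily v ω T K' y ∧ (∀ i ∈ A, ∀ j ≠ i, ∀ t, y i t ≠ y j t) ∧
      (∀ i, y i 0 = c i 0) ∧ ∀ i, y i T = c i T := by
    intro A
    induction A using Finset.induction_on with
    | empty => exact ⟨K, c, hc, by simp, fun _ => rfl, fun _ => rfl⟩
    | insert i A _ ih =>
      obtain ⟨K₁, y, hy, hA, h0, hT⟩ := ih
      obtain ⟨K₂, γ, hγ, hγ0, hγT, hav⟩ := hy.exists_update hdim hω i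
      refine ⟨K₂, _, hγ, fun k hk j hj t => ?_, fun k => ?_, fun k => ?_⟩
      · rcases eq_or_ne k i with rfl | hki
        · rw [Function.update_self, Function.update_of_ne hj]
          exact hav j hj t
        rw [Function.update_of_ne hki]
        rcases eq_or_ne j i with rfl | hji
        · rw [Function.update_self]
          exact (hav k hki t).symm
        · rw [Function.update_of_ne hji]
          exact hA k (Finset.mem_of_mem_insert_of_ne hk hki) j hj t
      · rcases eq_or_ne k i with rfl | hki
        · rw [Function.update_self, hγ0, h0]
        · rw [Function.update_of_ne hki, h0]
      · rcases eq_or_ne k i with rfl | hki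
        · rw [Function.update_self, hγT, hT]
        · rw [Function.update_of_ne hki, hT]
  obtain ⟨K', y, hy, hA, h0, hT⟩ := key Finset.univ
  refine ⟨K', y, hy, fun t i j hij => ?_, h0, hT⟩
  by_contra hne
  exact hA i (Finset.mem_univ i) j (Ne.symm hne) t hij

end Generic

/-! ### Order statistics of real curves -/

section Sorted

variable {n : ℕ}

/-- The `k`-th smallest (counting from `0`) of `n` real-valued functions, pointwise. -/
noncomputable def sortedCurve (f : Fin n → ℝ → ℝ) (k : Fin n) : ℝ → ℝ :=
  Finset.univ.inf' (Finset.univ_nonempty_iff.2 ⟨Fin.castLEEmb k.2⟩)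
    fun g : Fin (k + 1) ↪ Fin n => Finset.univ.sup' Finset.univ_nonempty fun l => f (g l)

theorem sortedCurve_apply (f : Fin n → ℝ → ℝ) (k : Fin n) (t : ℝ) :
    sortedCurve f k t = Finset.univ.inf' (Finset.univ_nonempty_iff.2 ⟨Fin.castLEEmb k.2⟩)
      fun g : Fin (k + 1) ↪ Fin n => Finset.univ.sup' Finset.univ_nonempty fun l => f (g l) t := by
  rw [sortedCurve, Finset.inf'_apply]
  congr 1
  funext g
  rw [Finset.sup'_apply]

theorem lipschitzWith_sortedCurve {f : Fin n → ℝ → ℝ} {L : ℝ≥0} (hf : ∀ i, LipschitzWith L (f i))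
    (k : Fin n) : LipschitzWith L (sortedCurve f k) := by
  refine Finset.inf'_induction (p := LipschitzWith L) _ _ (fun a ha b hb => ?_) fun g _ =>
    Finset.sup'_induction (p := LipschitzWith L) _ _ (fun a ha b hb => ?_) fun l _ => hf _
  · exact (ha.min hb : LipschitzWith (max L L) (a ⊓ b)).weaken (max_self L).le
  · exact (ha.max hb : LipschitzWith (max L L) (a ⊔ b)).weaken (max_self L).le

theorem exists_sortedCurve_eq (f : Fin n → ℝ → ℝ) (k : Fin n) (t : ℝ) :
    ∃ i, sortedCurve f k t = f i t := by
  rw [sortedCurve_apply]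
  obtain ⟨g, -, hg⟩ := Finset.exists_mem_eq_inf' (s := Finset.univ)
    (Finset.univ_nonempty_iff.2 ⟨Fin.castLEEmb k.2⟩)
    (fun g : Fin (k + 1) ↪ Fin n => Finset.univ.sup' Finset.univ_nonempty fun l => f (g l) t)
  obtain ⟨l, -, hl⟩ := Finset.exists_mem_eq_sup' (s := Finset.univ) Finset.univ_nonempty
    (fun l => f (g l) t)
  exact ⟨g l, hg.trans hl⟩

/-- From an optimal choice of `k' + 1` indices, dropping one of maximal value leaves enough indices
to compete for rank `k`. Equality of the two ranks then exhibits a second index with the same value.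
-/
theorem sortedCurve_lt_or_eq (f : Fin n → ℝ → ℝ) {k k' : Fin n} (hk : k < k') (t : ℝ) :
    sortedCurve f k t < sortedCurve f k' t ∨ (sortedCurve f k t = sortedCurve f k' t ∧
      ∃ i j, i ≠ j ∧ f i t = f j t ∧ f i t = sortedCurve f k t) := by
  obtain ⟨g, -, hg⟩ := Finset.exists_mem_eq_inf' (s := Finset.univ)
    (Finset.univ_nonempty_iff.2 ⟨Fin.castLEEmb k'.2⟩)
    (fun g : Fin (k' + 1) ↪ Fin n => Finset.univ.sup' Finset.univ_nonempty fun l => f (g l) t)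
  obtain ⟨m, -, hm⟩ := Finset.exists_mem_eq_sup' (s := Finset.univ) Finset.univ_nonempty
    (fun l => f (g l) t)
  have hk' : sortedCurve f k' t = f (g m) t := by rw [sortedCurve_apply, hg, hm]
  have hmax : ∀ l, f (g l) t ≤ f (g m) t := fun l => by
    rw [← hm]
    exact Finset.le_sup' (fun l => f (g l) t) (Finset.mem_univ l)
  set e : Fin (k + 1) ↪ Fin n :=
    ((Fin.castLEEmb (show (k : ℕ) + 1 ≤ k' from hk)).trans m.succAboveEmb).trans g
    with he
  have hle : sortedCurve f k t ≤ Finset.univ.sup' Finset.univ_nonempty fun l => f (e l) t := by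
    rw [sortedCurve_apply]
    exact Finset.inf'_le (fun g : Fin (k + 1) ↪ Fin n =>
      Finset.univ.sup' Finset.univ_nonempty fun l => f (g l) t) (Finset.mem_univ e)
  obtain ⟨l, -, hl⟩ := Finset.exists_mem_eq_sup' (s := Finset.univ) Finset.univ_nonempty
    (fun l => f (e l) t)
  rw [hl] at hle
  have hel : e l = g (m.succAbove (Fin.castLE hk l)) := rfl
  have hne : e l ≠ g m := fun h => by
    rw [hel] at h
    exact Fin.succAbove_ne m _ (g.injective h)
  have h1 : f (e l) t ≤ f (g m) t := by rw [hel]; exact hmax _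
  rcases (hle.trans h1).lt_or_eq with h | h
  · exact Or.inl (hk' ▸ h)
  · have h2 : f (e l) t = f (g m) t := le_antisymm h1 (h ▸ hle)
    exact Or.inr ⟨h.trans hk'.symm, e l, g m, hne, h2, h2.trans h.symm⟩

/-- If only `f i` has the sorted value at `t`, then by continuity the sorted curve differs from
every other `f j` near `t` and must follow `f i`. Sorting therefore preserves the differential
equation away from collisions. -/
theorem exists_sortedCurve_eventuallyEq {f : Fin n → ℝ → ℝ} (hf : ∀ i, Continuous (f i))
    (k : Fin n) {t : ℝ} (h : ∀ i j, i ≠ j → f i t = f j t → f i t ≠ sortedCurve f k t) :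
    ∃ i, sortedCurve f k t = f i t ∧ sortedCurve f k =ᶠ[nhds t] f i := by
  obtain ⟨L, hL⟩ : ∃ L, Continuous L ∧ L = sortedCurve f k := by
    refine ⟨_, ?_, rfl⟩
    have : sortedCurve f k = fun t => sortedCurve f k t := rfl
    rw [this]
    simp only [sortedCurve_apply]
    exact Continuous.finset_inf'_apply _ fun g _ => Continuous.finset_sup'_apply _ fun l _ => hf _
  obtain ⟨i, hi⟩ := exists_sortedCurve_eq f k t
  refine ⟨i, hi, ?_⟩
  have hev : ∀ j, j ≠ i → ∀ᶠ s in nhds t, sortedCurve f k s ≠ f j s := fun j hj => by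
    rw [← hL.2]
    refine (isOpen_ne_fun hL.1 (hf j)).mem_nhds fun heq => ?_
    rw [hL.2] at heq
    exact h i j hj.symm (hi.symm.trans heq) hi.symm
  have hev' : ∀ᶠ s in nhds t, ∀ j, j ≠ i → sortedCurve f k s ≠ f j s :=
    Filter.eventually_all.2 fun j => by
      by_cases hj : j = i
      · exact Filter.Eventually.of_forall fun _ h => absurd hj h
      · filter_upwards [hev j hj] with s hs _ using hs
  filter_upwards [hev'] with s hs
  obtain ⟨j, hj⟩ := exists_sortedCurve_eq f k s
  by_cases hji : j = i
  · rw [hj, hji]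
  · exact absurd hj (hs j hji)

end Sorted

/-! ### Removing collisions on the line -/

section Line

variable {n : ℕ} {v : EuclideanSpace ℝ (Fin 1) → EuclideanSpace ℝ (Fin 1)}
  {ω K : Set (EuclideanSpace ℝ (Fin 1))} {T : ℝ} {c : Fin n → ℝ → EuclideanSpace ℝ (Fin 1)}

theorem single_zero_apply_zero (x : EuclideanSpace ℝ (Fin 1)) :
    EuclideanSpace.single 0 (x 0) = x := by
  ext i
  rw [Subsingleton.elim i 0]
  simp

theorem single_zero_injective :
    Function.Injective fun r : ℝ => (EuclideanSpace.single 0 r : EuclideanSpace ℝ (Fin 1)) :=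
  fun r s h => by simpa using congrArg (fun x : EuclideanSpace ℝ (Fin 1) => x 0) h

theorem norm_eq_abs_apply_zero (x : EuclideanSpace ℝ (Fin 1)) : ‖x‖ = |x 0| := by
  rw [← single_zero_apply_zero x, PiLp.norm_single]
  simp

/-- On the line, the curves of a family can be sorted, so that they stay weakly ordered. -/
theorem IsSteeringFamily.exists_sorted (hc : IsSteeringFamily v ω T K c) :
    ∃ y : Fin n → ℝ → EuclideanSpace ℝ (Fin 1), IsSteeringFamily v ω T K y ∧
      (∀ i j, i < j → ∀ t, y i t 0 ≤ y j t 0) ∧ ∀ t i, ∃ j, y i t = c j t := by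
  set f : Fin n → ℝ → ℝ := fun i t => c i t 0 with hf
  set y : Fin n → ℝ → EuclideanSpace ℝ (Fin 1) := fun k t =>
    EuclideanSpace.single 0 (sortedCurve f k t) with hy
  have hcf : ∀ i t, c i t = EuclideanSpace.single 0 (f i t) := fun i t =>
    (single_zero_apply_zero _).symm
  choose L hL using fun i => (hc.free i).lipschitz
  have hLf : ∀ i, LipschitzWith (∑ i, L i) (f i) := fun i => by
    refine LipschitzWith.of_dist_le_mul fun s t => ?_
    have h1 := (hL i).dist_le_mul s t
    rw [dist_eq_norm, norm_eq_abs_apply_zero] at h1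
    rw [Real.dist_eq]
    refine h1.trans ?_
    gcongr
    exact_mod_cast Finset.single_le_sum (f := L) (fun _ _ => zero_le) (Finset.mem_univ i)
  have hev : ∀ k t, (y k t ∈ K → t ∉ Ioo 0 T) → ∃ i, y k t = c i t ∧ y k =ᶠ[nhds t] c i := by
    intro k t h
    obtain ⟨i, hi, hi'⟩ := exists_sortedCurve_eventuallyEq (fun i => (hLf i).continuous) k (t := t)
      (fun i j hij heq heq' => by
        have h1 := hc.collide i j hij t (by rw [hcf, hcf, heq])
        refine h ?_ h1.2
        have : y k t = c i t := by rw [hcf, heq']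
        rw [this]
        exact h1.1)
    refine ⟨i, by rw [hcf, ← hi], ?_⟩
    filter_upwards [hi'] with s hs
    rw [hcf, ← hs]
  refine ⟨y, ⟨hc.nonempty, hc.isCompact, hc.subset, fun k => ⟨⟨∑ i, L i, ?_⟩, fun t ht => ?_⟩,
    fun k t ht => ?_, fun k k' hk t hcol => ?_⟩, fun k k' hk t => ?_, fun t k => ?_⟩
  · refine LipschitzWith.of_dist_le_mul fun s t => ?_
    rw [dist_eq_norm, norm_eq_abs_apply_zero]
    simpa [hy, Real.dist_eq] using (lipschitzWith_sortedCurve hLf k).dist_le_mul s t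
  · obtain ⟨i, hi, hi'⟩ := hev k t fun h => absurd h ht
    rw [hi] at ht ⊢
    exact ((hc.free i).hasDerivAt t ht).congr_of_eventuallyEq hi'
  · obtain ⟨i, hi, hi'⟩ := hev k t fun _ h => absurd h.2 (not_lt.2 ht.le)
    rw [hi]
    exact (hc.late i t ht).congr_of_eventuallyEq hi'
  · have key : ∀ k k', k < k' → y k t = y k' t → y k t ∈ K ∧ t ∈ Ioo 0 T := by
      intro k k' hk hcol
      rcases sortedCurve_lt_or_eq f hk t with h | ⟨-, i, j, hij, h1, h2⟩
      · exact absurd (single_zero_injective hcol) h.ne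
      · have h3 := hc.collide i j hij t (by rw [hcf, hcf, h1])
        have : y k t = c i t := by rw [hcf, h2]
        rwa [this]
    rcases lt_or_gt_of_ne hk with h | h
    · exact key k k' h hcol
    · rw [hcol]
      exact key k' k h hcol.symm
  · have : sortedCurve f k t ≤ sortedCurve f k' t := by
      rcases sortedCurve_lt_or_eq f hk t with h | ⟨h, -⟩
      · exact h.le
      · exact h.le
    simpa [hy] using this
  · obtain ⟨i, hi⟩ := exists_sortedCurve_eq f k t
    exact ⟨i, by rw [hcf, ← hi]⟩

/-- After sorting, the `k`-th curve is shifted by the weight times `(k + 1) / (n + 1)`. Increasing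
factors separate curves that touch; factors below 1, with a 1-Lipschitz weight, keep the others in
order. -/
theorem IsSteeringFamily.exists_injective_of_line (hc : IsSteeringFamily v ω T K c)
    (hω : IsOpen ω) :
    ∃ (K' : Set (EuclideanSpace ℝ (Fin 1))) (y : Fin n → ℝ → EuclideanSpace ℝ (Fin 1)),
      IsSteeringFamily v ω T K' y ∧ (∀ t, Function.Injective fun i => y i t) ∧
      (∀ i, ∃ j, y i 0 = c j 0) ∧ ∀ i, ∃ j, y i T = c j T := by
  obtain ⟨y, hy, hmono, hyc⟩ := hc.exists_sorted
  obtain ⟨ρ, hρ, hcomp, hsub⟩ := hy.exists_cthickening hω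
  set r : Fin n → ℝ := fun k => ((k : ℕ) + 1 : ℝ) / (n + 1) with hr
  have hr0 : ∀ k, 0 < r k := fun k => by positivity
  have hr1 : ∀ k, r k < 1 := fun k => by
    rw [hr]
    simp only
    rw [div_lt_one (by positivity)]
    have : ((k : ℕ) : ℝ) < n := by exact_mod_cast k.2
    linarith
  have hrm : ∀ k k', k < k' → r k < r k' := fun k k' h => by
    have : ((k : ℕ) : ℝ) < (k' : ℕ) := by exact_mod_cast h
    simp only [hr]
    gcongr
  set θ : Fin n → EuclideanSpace ℝ (Fin 1) := fun k => EuclideanSpace.single 0 (r k) with hθ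
  have hθ1 : ∀ k, ‖θ k‖ ≤ 1 := fun k => by
    rw [hθ, PiLp.norm_single, Real.norm_of_nonneg (hr0 k).le]
    exact (hr1 k).le
  set z : Fin n → ℝ → EuclideanSpace ℝ (Fin 1) := fun k => spread K ρ T (θ k) (y k) with hz
  have hz0 : ∀ k t, z k t 0 = y k t 0 + spreadWeight K ρ T t (y k t) * r k := fun k t => by
    simp [hz, hθ, spread]
  have hlt : ∀ k k', k < k' → ∀ t, z k t 0 < z k' t 0 := by
    intro k k' hk t
    rw [hz0, hz0]
    rcases (hmono k k' hk t).lt_or_eq with h | h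
    · have h1 := abs_spreadWeight_sub_le (K := K) (ρ := ρ) (T := T) t (y k t) (y k' t)
      rw [norm_eq_abs_apply_zero, PiLp.sub_apply, abs_of_neg (sub_neg.2 h)] at h1
      have h2 := (le_abs_self _).trans h1
      have h3 := spreadWeight_nonneg (K := K) (ρ := ρ) (T := T) t (y k' t)
      have h4 : (spreadWeight K ρ T t (y k t) - spreadWeight K ρ T t (y k' t)) * r k
          ≤ (y k' t 0 - y k t 0) * r k := mul_le_mul_of_nonneg_right (by linarith) (hr0 k).le
      have h5 : (y k' t 0 - y k t 0) * r k < (y k' t 0 - y k t 0) * 1 :=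
        mul_lt_mul_of_pos_left (hr1 k) (sub_pos.2 h)
      have h6 : spreadWeight K ρ T t (y k' t) * r k ≤ spreadWeight K ρ T t (y k' t) * r k' :=
        mul_le_mul_of_nonneg_left (hrm k k' hk).le h3
      linarith
    · have heq : y k t = y k' t := by
        rw [← single_zero_apply_zero (y k t), h, single_zero_apply_zero]
      obtain ⟨h1, h2⟩ := hy.collide k k' hk.ne t heq
      rw [← heq]
      have := mul_lt_mul_of_pos_left (hrm k k' hk) (spreadWeight_pos (T := T) hρ h2 h1)
      linarith
  have hinj : ∀ t, Function.Injective fun i => z i t := by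
    intro t i j hij
    have hij : z i t = z j t := hij
    rcases lt_trichotomy i j with h | h | h
    · exact absurd (congrArg (fun x : EuclideanSpace ℝ (Fin 1) => x 0) hij) (hlt i j h t).ne
    · exact h
    · exact absurd (congrArg (fun x : EuclideanSpace ℝ (Fin 1) => x 0) hij) (hlt j i h t).ne'
  refine ⟨Metric.cthickening (2 * ρ) K, z,
    ⟨hy.nonempty.mono (Metric.self_subset_cthickening _), hcomp, hsub,
      fun i => (hy.free i).spread hy.nonempty hρ (hθ1 i),
      fun i t ht => hasDerivAt_spread_of_late ht (hy.late i t ht),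
      fun i j hij t hcol => absurd (hinj t hcol) hij⟩, hinj, fun i => ?_, fun i => ?_⟩
  · obtain ⟨j, hj⟩ := hyc 0 i
    exact ⟨j, by rw [← hj]; exact spread_eq_self_of_notMem_Ioo fun h => lt_irrefl _ h.1⟩
  · obtain ⟨j, hj⟩ := hyc T i
    exact ⟨j, by rw [← hj]; exact spread_eq_self_of_notMem_Ioo fun h => lt_irrefl _ h.2⟩

end Line

/-- Endpoints are kept only up to relabelling, because sorting on the line changes the labels. In
dimension zero any two curves would collide at time 0, which `collide` forbids. -/
theorem IsSteeringFamily.exists_injective {d n : ℕ}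
    {v : EuclideanSpace ℝ (Fin d) → EuclideanSpace ℝ (Fin d)}
    {ω K : Set (EuclideanSpace ℝ (Fin d))} {T : ℝ} {c : Fin n → ℝ → EuclideanSpace ℝ (Fin d)}
    (hc : IsSteeringFamily v ω T K c) (hω : IsOpen ω) :
    ∃ (K' : Set (EuclideanSpace ℝ (Fin d))) (y : Fin n → ℝ → EuclideanSpace ℝ (Fin d)),
      IsSteeringFamily v ω T K' y ∧ (∀ t, Function.Injective fun i => y i t) ∧
      (∀ i, ∃ j, y i 0 = c j 0) ∧ ∀ i, ∃ j, y i T = c j T := by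
  match d with
  | 0 =>
    refine ⟨K, c, hc, fun t i j hij => ?_, fun i => ⟨i, rfl⟩, fun i => ⟨i, rfl⟩⟩
    by_contra hne
    exact lt_irrefl _ (hc.collide i j hne 0 (Subsingleton.elim _ _)).2.1
  | 1 => exact hc.exists_injective_of_line hω
  | d + 2 =>
    obtain ⟨K', y, h, hinj, h0, hT⟩ := hc.exists_injective_of_two_le_finrank (by simp) hω
    exact ⟨K', y, h, hinj, fun i => ⟨i, h0 i⟩, fun i => ⟨i, hT i⟩⟩

/-! ### Masses of empirical measures as counts -/

section Empirical

variable {d n : ℕ}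

theorem empiricalMeasure_apply (x : Fin n → EuclideanSpace ℝ (Fin d))
    (s : Set (EuclideanSpace ℝ (Fin d))) :
    empiricalMeasure x s = ∑ i, (n : ℝ≥0∞)⁻¹ * s.indicator 1 (x i) := by
  simp [empiricalMeasure, Measure.finsetSum_apply]

theorem mem_support_empiricalMeasure (x : Fin n → EuclideanSpace ℝ (Fin d)) (i : Fin n) :
    x i ∈ (empiricalMeasure x).support := by
  rw [Measure.mem_support_iff_forall]
  intro U hU
  rw [empiricalMeasure_apply]
  refine lt_of_lt_of_le ?_ (Finset.single_le_sum (fun _ _ => zero_le) (Finset.mem_univ i))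
  rw [indicator_of_mem (mem_of_mem_nhds hU)]
  simp

theorem empiricalMeasure_support_sep (x : Fin n → EuclideanSpace ℝ (Fin d))
    (P : EuclideanSpace ℝ (Fin d) → Prop) [DecidablePred fun i => P (x i)] :
    empiricalMeasure x {z | z ∈ (empiricalMeasure x).support ∧ P z} =
      (Finset.univ.filter fun i => P (x i)).card * (n : ℝ≥0∞)⁻¹ := by
  rw [empiricalMeasure_apply, ← Finset.mul_sum, mul_comm, Finset.card_filter]
  congr 1
  push_cast
  refine Finset.sum_congr rfl fun i _ => ?_
  by_cases h : P (x i)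
  · rw [indicator_of_mem (show _ ∈ {z | _ ∧ _} from ⟨mem_support_empiricalMeasure x i, h⟩), if_pos h]
    rfl
  · rw [indicator_of_notMem (fun h' => h h'.2), if_neg h]

end Empirical

/-! ### Opposite quantiles and the optimal pairing -/

section Quantile

variable {n : ℕ}

/-- The distribution function of the uniform measure on the values of `α`. -/
noncomputable def countingCDF (α : Fin n → ℝ≥0) (t : ℝ≥0) : ℝ≥0∞ :=
  (Finset.univ.filter fun i => α i ≤ t).card * (n : ℝ≥0∞)⁻¹

theorem le_generalizedInverse_countingCDF {α : Fin n → ℝ≥0} {m : ℝ≥0∞} {a : ℝ≥0}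
    (h : (Finset.univ.filter fun i => α i < a).card * (n : ℝ≥0∞)⁻¹ < m) :
    (a : ℝ≥0∞) ≤ generalizedInverse (countingCDF α) m := by
  refine le_iInf₂ fun t ht => ENNReal.coe_le_coe.2 ?_
  by_contra! hlt
  refine absurd (ht.trans ?_) (not_le.2 h)
  unfold countingCDF
  gcongr

/-- The largest value below the quantile would be an admissible time in the infimum if the count
reached `m`. Some value must lie below: for `m = 0` an empty count is not less than `m`. -/
theorem card_lt_generalizedInverse_countingCDF {α : Fin n → ℝ≥0} {m : ℝ≥0∞}
    (h : ∃ i, (α i : ℝ≥0∞) < generalizedInverse (countingCDF α) m) :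
    (Finset.univ.filter fun i => (α i : ℝ≥0∞) < generalizedInverse (countingCDF α) m).card
      * (n : ℝ≥0∞)⁻¹ < m := by
  set P := Finset.univ.filter fun i => (α i : ℝ≥0∞) < generalizedInverse (countingCDF α) m with hP
  obtain ⟨j, hj⟩ := h
  obtain ⟨i, hi, hmax⟩ := Finset.exists_max_image P α ⟨j, by simpa [hP] using hj⟩
  by_contra! hm
  have h1 : m ≤ countingCDF α (α i) := hm.trans (by
    unfold countingCDF
    gcongr
    intro k hk
    simpa using hmax k hk)
  have h2 : generalizedInverse (countingCDF α) m ≤ α i :=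
    iInf₂_le (f := fun (t : ℝ≥0) (_ : m ≤ countingCDF α t) => (t : ℝ≥0∞)) (α i) h1
  have h3 : (α i : ℝ≥0∞) < generalizedInverse (countingCDF α) m := by simpa [hP] using hi
  exact absurd h2 (not_le.2 h3)

/-- The supremum of the sums of opposite quantiles of two families. -/
noncomputable def oppositeQuantileSup (α β : Fin n → ℝ≥0) : ℝ≥0∞ :=
  ⨆ m ∈ Icc (0 : ℝ≥0∞) 1,
    generalizedInverse (countingCDF α) m + generalizedInverse (countingCDF β) (1 - m)

/-- If quantiles `A` and `B` had a sum above every `α i + β (σ i)`, each `i` would satisfy `α i < A`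
or `β (σ i) < B`. These two index sets would have total mass at least 1, whereas their masses lie
below `m` and `1 - m`. -/
theorem exists_oppositeQuantileSup_le (hn : 0 < n) (α β : Fin n → ℝ≥0) (σ : Equiv.Perm (Fin n)) :
    ∃ i, oppositeQuantileSup α β ≤ α i + β (σ i) := by
  have : Nonempty (Fin n) := ⟨⟨0, hn⟩⟩
  obtain ⟨i₀, hi₀⟩ := Finite.exists_max fun i => (α i + β (σ i) : ℝ≥0∞)
  refine ⟨i₀, iSup₂_le fun m hm => ?_⟩
  set A := generalizedInverse (countingCDF α) m with hA
  set B := generalizedInverse (countingCDF β) (1 - m) with hB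
  by_contra! hlt
  set P := Finset.univ.filter fun i => (α i : ℝ≥0∞) < A with hP
  set Q := Finset.univ.filter fun i => (β i : ℝ≥0∞) < B with hQ
  have hcover : ∀ i, i ∈ P ∨ σ i ∈ Q := fun i => by
    by_contra! hcon
    simp only [hP, hQ, Finset.mem_filter, Finset.mem_univ, true_and, not_lt] at hcon
    exact absurd ((add_le_add hcon.1 hcon.2).trans (hi₀ i)) (not_le.2 hlt)
  have hn0 : (n : ℝ≥0∞) ≠ 0 := by exact_mod_cast hn.ne'
  have hone : (n : ℝ≥0∞) * (n : ℝ≥0∞)⁻¹ = 1 :=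
    ENNReal.mul_inv_cancel hn0 (ENNReal.natCast_ne_top n)
  have hcard : n ≤ P.card + Q.card := by
    have h1 : (Finset.univ : Finset (Fin n)) ⊆ P ∪ Q.map σ.symm.toEmbedding := fun i _ => by
      rcases hcover i with h | h
      · exact Finset.mem_union_left _ h
      · exact Finset.mem_union_right _ (Finset.mem_map.2 ⟨σ i, h, by simp⟩)
    have h2 := (Finset.card_le_card h1).trans (Finset.card_union_le _ _)
    simpa using h2
  have hcard' : (1 : ℝ≥0∞) ≤ P.card * (n : ℝ≥0∞)⁻¹ + Q.card * (n : ℝ≥0∞)⁻¹ := by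
    rw [← hone, ← add_mul]
    gcongr
    exact_mod_cast hcard
  have hPlt : P.Nonempty → P.card * (n : ℝ≥0∞)⁻¹ < m := fun ⟨i, hi⟩ =>
    card_lt_generalizedInverse_countingCDF ⟨i, by simpa [hP] using hi⟩
  have hQlt : Q.Nonempty → Q.card * (n : ℝ≥0∞)⁻¹ < 1 - m := fun ⟨i, hi⟩ =>
    card_lt_generalizedInverse_countingCDF ⟨i, by simpa [hQ] using hi⟩
  rcases P.eq_empty_or_nonempty with hPe | hPn
  · rcases Q.eq_empty_or_nonempty with hQe | hQn
    · rw [hPe, hQe] at hcard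
      simp at hcard
      omega
    · rw [hPe] at hcard'
      simp only [Finset.card_empty, Nat.cast_zero, zero_mul, zero_add] at hcard'
      exact absurd (hcard'.trans_lt (hQlt hQn)) (not_lt.2 tsub_le_self)
  · rcases Q.eq_empty_or_nonempty with hQe | hQn
    · rw [hQe] at hcard'
      simp only [Finset.card_empty, Nat.cast_zero, zero_mul, add_zero] at hcard'
      exact absurd (hcard'.trans_lt (hPlt hPn)) (not_lt.2 hm.2)
    · have h := hcard'.trans_lt (ENNReal.add_lt_add (hPlt hPn) (hQlt hQn))
      rw [add_tsub_cancel_of_le hm.2] at h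
      exact lt_irrefl _ h

theorem card_lt_sort_le (α : Fin n → ℝ≥0) (k : Fin n) :
    (Finset.univ.filter fun i => α i < α (Tuple.sort α k)).card ≤ k := by
  have h : (Finset.univ.filter fun i => α i < α (Tuple.sort α k)) ⊆
      (Finset.Iio k).map (Tuple.sort α).toEmbedding := fun i hi => by
    simp only [Finset.mem_filter, Finset.mem_univ, true_and] at hi
    refine Finset.mem_map.2 ⟨(Tuple.sort α).symm i, Finset.mem_Iio.2 ?_, by simp⟩
    by_contra! hle
    have := Tuple.monotone_sort α hle
    simp only [Function.comp_apply, Equiv.apply_symm_apply] at this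
    exact absurd hi (not_lt.2 this)
  simpa using Finset.card_le_card h

/-- The `k`-th smallest `α` is paired with the `k`-th largest `β`. Testing at the level `(k + 1/2) /
n`, strictly between two jumps, makes both quantiles at least the paired values. -/
theorem exists_perm_le_oppositeQuantileSup (α β : Fin n → ℝ≥0) :
    ∃ σ : Equiv.Perm (Fin n), ∀ i, (α i + β (σ i) : ℝ≥0∞) ≤ oppositeQuantileSup α β := by
  refine ⟨(Tuple.sort α).symm.trans (Fin.revPerm.trans (Tuple.sort β)), fun i => ?_⟩
  obtain ⟨k, rfl⟩ := (Tuple.sort α).surjective i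
  simp only [Equiv.trans_apply, Equiv.symm_apply_apply, Fin.revPerm_apply]
  have hkn : ((k : ℕ) : ℝ) + 1 ≤ n := by exact_mod_cast k.2
  have hn : (0 : ℝ) < n := by linarith [(Nat.cast_nonneg k : (0 : ℝ) ≤ ((k : ℕ) : ℝ))]
  set μ : ℝ := ((k : ℕ) + 1 / 2 : ℝ) / n with hμ
  have hμ0 : 0 ≤ μ := by positivity
  have hμ1 : μ ≤ 1 := by
    rw [hμ, div_le_one hn]
    linarith
  have hfrac : ∀ c : ℕ, (c : ℝ≥0∞) * (n : ℝ≥0∞)⁻¹ = ENNReal.ofReal (c / n) := fun c => by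
    rw [ENNReal.ofReal_div_of_pos hn, ENNReal.ofReal_natCast, ENNReal.ofReal_natCast,
      div_eq_mul_inv]
  have hsub : 1 - ENNReal.ofReal μ = ENNReal.ofReal (1 - μ) := by
    rw [ENNReal.ofReal_sub _ hμ0, ENNReal.ofReal_one]
  have hμlt : μ < 1 := by
    rw [hμ, div_lt_one hn]
    linarith
  have h1 : (α (Tuple.sort α k) : ℝ≥0∞) ≤
      generalizedInverse (countingCDF α) (ENNReal.ofReal μ) := by
    refine le_generalizedInverse_countingCDF ?_
    rw [hfrac]
    refine (ENNReal.ofReal_lt_ofReal_iff (by positivity)).2 ?_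
    rw [hμ]
    gcongr
    have : ((Finset.univ.filter fun i => α i < α (Tuple.sort α k)).card : ℝ) ≤ (k : ℕ) := by
      exact_mod_cast card_lt_sort_le α k
    linarith
  have h2 : (β (Tuple.sort β k.rev) : ℝ≥0∞) ≤
      generalizedInverse (countingCDF β) (1 - ENNReal.ofReal μ) := by
    refine le_generalizedInverse_countingCDF ?_
    rw [hfrac, hsub]
    refine (ENNReal.ofReal_lt_ofReal_iff (by linarith)).2 ?_
    have hrev : (k.rev : ℕ) + (k + 1) = n := by
      rw [Fin.val_rev]
      omega
    have h3 : ((Finset.univ.filter fun i => β i < β (Tuple.sort β k.rev)).card : ℝ)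
        + ((k : ℕ) + 1) ≤ n := by
      have := card_lt_sort_le β k.rev
      exact_mod_cast (by omega : (Finset.univ.filter fun i => β i < β (Tuple.sort β k.rev)).card
        + ((k : ℕ) + 1) ≤ n)
    rw [hμ, div_lt_iff₀ hn, sub_mul, div_mul_cancel₀ _ hn.ne']
    linarith
  refine (add_le_add h1 h2).trans ?_
  exact le_iSup₂ (f := fun (m : ℝ≥0∞) (_ : m ∈ Icc (0 : ℝ≥0∞) 1) =>
    generalizedInverse (countingCDF α) m + generalizedInverse (countingCDF β) (1 - m))
    (ENNReal.ofReal μ) ⟨zero_le, by simpa using hμ1⟩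

theorem macroscopicTime_empiricalMeasure {d : ℕ}
    {v : EuclideanSpace ℝ (Fin d) → EuclideanSpace ℝ (Fin d)}
    {ω : Set (EuclideanSpace ℝ (Fin d))} {x₀ x₁ : Fin n → EuclideanSpace ℝ (Fin d)}
    {α β : Fin n → ℝ≥0} (hα : ∀ i, entryTime v ω (x₀ i) = α i)
    (hβ : ∀ i, backwardEntryTime v ω (x₁ i) = β i) :
    macroscopicTime v ω (empiricalMeasure x₀) (empiricalMeasure x₁) = oppositeQuantileSup α β := by
  classical
  have h1 : forwardMass v ω (empiricalMeasure x₀) = countingCDF α := by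
    funext t
    rw [forwardMass, empiricalMeasure_support_sep x₀ fun z => entryTime v ω z ≤ t]
    simp only [hα, ENNReal.coe_le_coe, countingCDF]
  have h2 : backwardMass v ω (empiricalMeasure x₁) = countingCDF β := by
    funext t
    rw [backwardMass, empiricalMeasure_support_sep x₁ fun z => backwardEntryTime v ω z ≤ t]
    simp only [hβ, ENNReal.coe_le_coe, countingCDF]
  rw [macroscopicTime, h1, h2, oppositeQuantileSup]

end Quantile

/-! ### Controllable times and the infimum time -/

section Main

variable {d n : ℕ} {v : EuclideanSpace ℝ (Fin d) → EuclideanSpace ℝ (Fin d)} {K M : ℝ≥0}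
  {ω : Set (EuclideanSpace ℝ (Fin d))} {x₀ x₁ : Fin n → EuclideanSpace ℝ (Fin d)}
  {α β : Fin n → ℝ≥0}

theorem exactlyControllable_of_add_lt (hK : LipschitzWith K v) (hM : ∀ x, ‖v x‖ ≤ M)
    (hω : IsOpen ω) (hconn : IsConnected ω) (hx₀ : Function.Injective x₀)
    (hx₁ : Function.Injective x₁) (hα : ∀ i, IsEntryTime v ω (x₀ i) (α i))
    (hβ : ∀ i, IsEntryTime (-v) ω (x₁ i) (β i)) {T : ℝ≥0} {σ : Equiv.Perm (Fin n)}
    (hσ : ∀ i, α i + β (σ i) < T) : ExactlyControllable v ω x₀ x₁ T := by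
  obtain ⟨C, c, hc, hc0, hcT⟩ := exists_isSteeringFamily hK hM hω hconn hx₀ hx₁ hα hβ
    (T := T) (fun i => by exact_mod_cast le_self_add.trans_lt (hσ i)) (σ := σ)
    (fun i => by exact_mod_cast hσ i)
  obtain ⟨C', y, hy, hinj, hy0, hyT⟩ := hc.exists_injective hω
  refine exactlyControllable_of_curves hK.continuous hM hω hy.isCompact hy.subset hy.free hinj
    (fun t i ht => hy.late i t ht) (fun i => ?_) (fun i => ?_)
  · obtain ⟨j, hj⟩ := hy0 i
    exact ⟨j, hj.trans (hc0 j)⟩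
  · obtain ⟨j, hj⟩ := hyT i
    exact ⟨σ j, hj.trans (hcT j)⟩

/-- A controlled trajectory from `p` to `q` takes more time than the sum of the entry times, when it
takes more time than the entry time of `p`. -/
theorem IsControlledTrajectory.add_lt (hK : LipschitzWith K v) (hM : ∀ x, ‖v x‖ ≤ M)
    (hω : IsOpen ω) {u : EuclideanSpace ℝ (Fin d) → ℝ → EuclideanSpace ℝ (Fin d)}
    (hu : IsAdmissibleControl ω u) {p q : EuclideanSpace ℝ (Fin d)}
    {X : ℝ → EuclideanSpace ℝ (Fin d)} (hX : IsControlledTrajectory v ω u p X) {a b T : ℝ}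
    (ha : IsEntryTime v ω p a) (hb : IsEntryTime (-v) ω q b) (haT : a < T) (hq : X T = q) :
    a + b < T := by
  by_contra! hle
  have h1 := hX.eq_vectorFlow hK hM hu ha.nonneg ha.notMem a ⟨ha.nonneg, le_rfl⟩
  -- Since `T - a ≤ b`, the free final part reaches back to time `a`, where the free initial part
  -- ends; together they make the whole trajectory free.
  have h2 := hX.eq_vectorFlow_backward hK hM hu (R := T - a) (by linarith) (by linarith [ha.nonneg])
    hq (fun t ht htR => hb.notMem t ht (by linarith)) (T - a) ⟨by linarith, le_rfl⟩
  rw [sub_sub_cancel, h1, ← vectorFlow_neg_time hK hM] at h2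
  have hflow : vectorFlow v T p = q := by
    rw [show T = (T - a) + a by ring, vectorFlow_add hK hM, h2, ← vectorFlow_add hK hM,
      add_neg_cancel, vectorFlow_zero hK hM]
  exact absurd (ha.add_lt_of_vectorFlow_eq hK hM hω hb haT hflow) (not_lt.2 hle)

theorem IsEntryTime.finite_hitting (hK : LipschitzWith K v) (hM : ∀ x, ‖v x‖ ≤ M)
    {p : EuclideanSpace ℝ (Fin d)} {a : ℝ≥0} (ha : IsEntryTime v ω p a)
    (x : Fin n → EuclideanSpace ℝ (Fin d)) :
    {T : ℝ≥0 | T ≤ a ∧ vectorFlow v T p ∈ range x}.Finite := by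
  refine Set.Finite.of_finite_image (f := fun T : ℝ≥0 => vectorFlow v T p)
    ((finite_range x).subset ?_) fun s hs t ht hst => ?_
  · rintro _ ⟨T, hT, rfl⟩
    exact hT.2
  · exact NNReal.coe_injective (ha.injOn_vectorFlow hK hM ⟨s.2, by exact_mod_cast hs.1⟩
      ⟨t.2, by exact_mod_cast ht.1⟩ hst)

/-- If `T` is at most the maximum, attained at some `i`, either the trajectory from `x₀ i` or the
one ending at `x₁ i` is free on `[0, T]`, so `T` is a hitting time of a finite set. -/
theorem finite_exceptional_times (hn : 0 < n) (hK : LipschitzWith K v) (hM : ∀ x, ‖v x‖ ≤ M)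
    (hα : ∀ i, IsEntryTime v ω (x₀ i) (α i)) (hβ : ∀ i, IsEntryTime (-v) ω (x₁ i) (β i)) :
    {T : ℝ≥0 | (T : ℝ≥0∞) ≤ ⨆ i, max (α i : ℝ≥0∞) (β i) ∧
      ExactlyControllable v ω x₀ x₁ T}.Finite := by
  have : Nonempty (Fin n) := ⟨⟨0, hn⟩⟩
  have hM' : ∀ x, ‖(-v) x‖ ≤ M := fun x => by simpa using hM x
  refine ((finite_iUnion fun i => (hα i).finite_hitting hK hM x₁).union
    (finite_iUnion fun i => (hβ i).finite_hitting hK.neg hM' x₀)).subset ?_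
  rintro T ⟨hT, u, hu, X, hX, σ, hσ⟩
  obtain ⟨i, hi⟩ := exists_eq_ciSup_of_finite (f := fun i => max (α i : ℝ≥0∞) (β i))
  rw [← hi] at hT
  rcases le_max_iff.1 hT with h | h
  · have h : T ≤ α i := by exact_mod_cast h
    refine Or.inl (mem_iUnion.2 ⟨i, h, σ i, ?_⟩)
    rw [← hσ]
    exact (hX i).eq_vectorFlow hK hM hu T.coe_nonneg
      (fun t ht htT => (hα i).notMem t ht (htT.trans_le (by exact_mod_cast h))) T ⟨T.coe_nonneg, le_rfl⟩
  · have h : T ≤ β i := by exact_mod_cast h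
    refine Or.inr (mem_iUnion.2 ⟨i, h, σ.symm i, ?_⟩)
    have h1 := (hX (σ.symm i)).eq_vectorFlow_backward hK hM hu T.coe_nonneg le_rfl (q := x₁ i)
      (by rw [hσ, Equiv.apply_symm_apply])
      (fun t ht htT => (hβ i).notMem t ht (htT.trans_le (by exact_mod_cast h))) T ⟨T.coe_nonneg, le_rfl⟩
    rw [← h1, sub_self, ((hX (σ.symm i)) 0 le_rfl).2]
    simp

/-- The infimum time for exact control is unique. -/
theorem IsExactInfimumTime.eq {S τ : ℝ≥0∞} (hS : IsExactInfimumTime v ω x₀ x₁ S) (hS' : S ≠ ∞)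
    (hle : maxEntryTime v ω x₀ x₁ ≤ S) (hτ : IsExactInfimumTime v ω x₀ x₁ τ) : τ = S := by
  lift S to ℝ≥0 using hS'
  rcases lt_trichotomy τ S with h | h | h
  · exfalso
    -- If `S` is strictly above the maximal entry time, `S` itself is a forbidden controllable time.
    -- In case of equality every time in `(τ, S]` would be exceptional, which is infinitely many.
    rcases hle.lt_or_eq with h' | h'
    · exact hS.not_controllable S h' le_rfl (hτ.controllable S h)
    · lift τ to ℝ≥0 using h.ne_top
      refine (Ioc_infinite (ENNReal.coe_lt_coe.1 h)) (hτ.finite_exceptional.subset fun T hT => ?_)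
      exact ⟨h' ▸ ENNReal.coe_le_coe.2 hT.2, hτ.controllable T (ENNReal.coe_lt_coe.2 hT.1)⟩
  · exact h
  · exfalso
    obtain ⟨T, hST, hTτ⟩ := ENNReal.lt_iff_exists_nnreal_btwn.1 h
    exact hτ.not_controllable T (hle.trans_lt hST) hTτ.le (hS.controllable T hST)

end Main

theorem corollary3p3 {d n : ℕ} (hn : 0 < n)
    (v : EuclideanSpace ℝ (Fin d) → EuclideanSpace ℝ (Fin d))
    (hv_lip : ∃ K : ℝ≥0, LipschitzWith K v) (hv_bdd : ∃ M : ℝ≥0, ∀ x, ‖v x‖ ≤ M)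
    (ω : Set (EuclideanSpace ℝ (Fin d))) (hω_open : IsOpen ω) (hω_conn : IsConnected ω)
    (hω_bdd : Bornology.IsBounded ω)
    (x₀ x₁ : Fin n → EuclideanSpace ℝ (Fin d))
    (hx₀ : Function.Injective x₀) (hx₁ : Function.Injective x₁)
    (hgeo : GeometricCondition v ω (empiricalMeasure x₀) (empiricalMeasure x₁)) :
    macroscopicTime v ω (empiricalMeasure x₀) (empiricalMeasure x₁) ≠ ∞ ∧
    ∀ τ : ℝ≥0∞, IsExactInfimumTime v ω x₀ x₁ τ ↔
      τ = macroscopicTime v ω (empiricalMeasure x₀) (empiricalMeasure x₁) := by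
  obtain ⟨K, hK⟩ := hv_lip
  obtain ⟨M, hM⟩ := hv_bdd
  choose α hα hα' using fun i =>
    exists_isEntryTime (hgeo.1 (x₀ i) (mem_support_empiricalMeasure x₀ i))
  have hback : ∀ i, ∃ t : ℝ, 0 < t ∧ vectorFlow (-v) t (x₁ i) ∈ ω := fun i => by
    obtain ⟨t, ht, h⟩ := hgeo.2 (x₁ i) (mem_support_empiricalMeasure x₁ i)
    exact ⟨t, ht, vectorFlow_neg_time hK hM t (x₁ i) ▸ h⟩
  choose β hβ hβ' using fun i => exists_isEntryTime (hback i)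
  simp only [← backwardEntryTime_eq_entryTime_neg hK hM] at hβ
  rw [macroscopicTime_empiricalMeasure hα hβ]
  set S := oppositeQuantileSup α β
  have hfin : S ≠ ∞ := by
    obtain ⟨i, hi⟩ := exists_oppositeQuantileSup_le hn α β 1
    exact ne_top_of_le_ne_top (by simp) hi
  have hmax : maxEntryTime v ω x₀ x₁ = ⨆ i, max (α i : ℝ≥0∞) (β i) := by
    simp only [maxEntryTime, hα, hβ]
  obtain ⟨σ, hσ⟩ := exists_perm_le_oppositeQuantileSup α β
  -- Every single entry time occurs in one of the pair sums bounded by `S`.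
  have hle : maxEntryTime v ω x₀ x₁ ≤ S := by
    rw [hmax]
    refine iSup_le fun i => max_le (le_self_add.trans (hσ i)) ?_
    have := hσ (σ.symm i)
    rw [Equiv.apply_symm_apply] at this
    exact le_add_self.trans this
  have hS : IsExactInfimumTime v ω x₀ x₁ S := by
    refine ⟨fun T hT => ?_, fun T hT hTS => ?_, hmax ▸ finite_exceptional_times hn hK hM hα' hβ'⟩
    · exact exactlyControllable_of_add_lt hK hM hω_open hω_conn hx₀ hx₁ hα' hβ' (σ := σ)
        fun i => by exact_mod_cast (hσ i).trans_lt hT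
    · rintro ⟨u, hu, X, hX, ρ, hρ⟩
      obtain ⟨i, hi⟩ := exists_oppositeQuantileSup_le hn α β ρ
      have hiT : α i < T := by
        rw [hmax] at hT
        exact_mod_cast ((le_max_left _ _).trans
          (le_iSup (fun i => max (α i : ℝ≥0∞) (β i)) i)).trans_lt hT
      have h1 : (T : ℝ) ≤ α i + β (ρ i) := by exact_mod_cast hTS.trans hi
      exact absurd ((hX i).add_lt hK hM hω_open hu (hα' i) (hβ' (ρ i)) (by exact_mod_cast hiT)
        (hρ i)) (not_lt.2 h1)
  exact ⟨hfin, fun τ => ⟨fun hτ => hS.eq hfin hle hτ, fun h => h ▸ hS⟩⟩
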